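/- **Networks.** A network on the points $1,\dots,n$ is a set of directed edges $(i,j)$, $1\le i<j\le n$, in which no point has both an incoming and an outgoing edge. Let $\mathcal N(n)$ be the set of those networks in which, whenever $(i,k)$ and $(j,l)$ are edges with $i<j<k<l$, also $(j,k)$ is an edge. For $\pi\in\mathcal S_n$ the edge set $N(\pi)$ is produced as follows, starting with $m=n$: if $\pi_m=m$, replace $m$ by $m-1$; otherwise let $j$ be the least position with $\pi_j>\pi_m$, record the edge $(j,m)$, exchange the entries in positions $j$ and $m$, and repeat. The procedure stops at the identity. **Polyominoes.** Let $P$ be a non-empty finite edge-connected set of unit squares of the plane grid, whose left-most column has number $1$, such that $P$ has no holes, the heights of the north edges of $P$ weakly decrease from left to right, and the heights of the south edges of $P$ are unimodal from left to right ($s_1\ge\dots\ge s_k\le\dots\le s_m$). (Only edges in different columns are compared; edges are boundary edges.) **Labeling.** *East edges.* The label of the east edge of a square in column $j$ is first written in column $j+1$ of its row. Passing the rows above it one after the other from bottom to top, it is moved right by one column for each row whose east edge lies to the left of the current column of the label. The value of the label is $j+1+x$, where $x$ is the number of moves made when all rows above have been passed. A south edge has the label of an east edge below it if that label, on its way up,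 arrives in the column of the south edge below that edge, with no square of $P$ in between in that column. *South edges.* Let $E$ be the set of labels of the east edges. The $i$-th from left of the south edges that have no label of an east edge below them gets the $i$-th smallest element of $\mathbb Z_{\ge1}\setminus E$ as label, written directly below it; but if it is not strictly left of all squares of the lowest row of $P$, its label is moved down and written directly below the lowest row. Let $\alpha(P)$ be the word obtained by reading all labels row by row from top to bottom, each row from left to right. **Edges.** Let $c_r$ be the square whose east edge has the maximal east label $\ell$ and $c_l$ the square in the lowest row whose south edge has the minimal label. Let $\mathrm{Rib}(P)$ be the ribbon from $c_r$ to $c_l$ along the south-east boundary of $P$, i.e. the squares of $P$ in the columns weakly right of $c_l$ and the rows weakly below $c_r$ whose south-east diagonal neighbour is not in $P$. A Dyck tile is a ribbon whose square centres form a path of up and right steps, with equally many of both, no initial part of which has more right than up steps (a single square is allowed). Tile $\mathrm{Rib}(P)$ by the Dyck tiles of maximal size, i.e. those not contained in a larger Dyck tile in $\mathrm{Rib}(P)$. Let $l_1,\dots,l_t$ be the labels of the south-most edges of the tiles (the south edges of their lowest, left-most squares), and $l_{\min}$ the least of them. Let $L_\downarrow$ be the set of south labels in columns strictly left of the square with label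 $l_{\min}$ and in rows strictly below the label $\ell$. Put $$\mathcal E'(P)=\{(l_i,\ell):1\le i\le t\}\cup\{(i,\ell):i\in L_\downarrow\}.$$ Let $P_1$ arise from $P$ by deleting $\mathrm{Rib}(P)$ and the squares whose south edges have labels in $L_\downarrow$, and then moving all squares weakly below the row of $c_r$ right by one unit. Iterate: $P=P_0\to P_1\to P_2\to\cdots$. Columns keep their numbers throughout, and in counting south edges from left, a column without squares of $P_i$ counts as one south edge. Put $\mathcal E'(\emptyset)=\emptyset$ and $\mathcal E(P)=\bigcup_{i\ge0}\mathcal E'(P_i)$. **Theorem.** For every such $P$, the word $\alpha(P)$ is the one-line notation of a permutation $\pi\in\mathcal S_n$ for some $n$, the sequence $P_0\to P_1\to\cdots$ reaches $\emptyset$, the set $\mathcal E(P)$ is the edge set of a network in $\mathcal N(n)$, and $$\mathcal E(P)=N(\pi^{-1}).$$ -/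

import Mathlib

namespace PolyNet

/-! ### Networks and permutations -/

/-- `E` is the edge set of a network on the points `1, …, n` satisfying the crossing condition:
every edge `(i, j)` goes from `i` to some `j > i`; no point has both an incoming and an outgoing
edge (so every point is a source, a sink or neutral); and if `(i, k)` and `(j, l)` are edges with
`i < j < k < l`, then `(j, k)` is an edge. -/
structure IsNetwork (n : ℕ) (E : Set (ℤ × ℤ)) : Prop where
  edge : ∀ e ∈ E, 1 ≤ e.1 ∧ e.1 < e.2 ∧ e.2 ≤ (n : ℤ)
  source_sink : ∀ i j k : ℤ, (i, j) ∈ E → (j, k) ∉ E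
  crossing : ∀ i j k l : ℤ, i < j → j < k → k < l → (i, k) ∈ E → (j, l) ∈ E → (j, k) ∈ E

/-- `π` is a permutation of `{1, …, n}` (extended by the identity to all integers). -/
def IsPermutation (n : ℕ) (π : Equiv.Perm ℤ) : Prop :=
  ∀ i : ℤ, i ∉ Set.Icc (1 : ℤ) n → π i = i

/-- One-line notation `π 1, π 2, …, π n`. -/
def oneLine (n : ℕ) (π : Equiv.Perm ℤ) : List ℤ :=
  (List.range n).map fun k => π ((k : ℤ) + 1)

/-- `PermEdge m π e`: the edge `e` is produced by the following procedure applied to the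
permutation `π` of `{1, …, m}`. If the last entry `π m` is `m`, go on with the first `m - 1`
entries. Otherwise let `j` be the first position with `π j > π m`; produce the edge `(j, m)`,
exchange the entries in the positions `j` and `m`, and repeat. -/
inductive PermEdge : ℕ → Equiv.Perm ℤ → ℤ × ℤ → Prop
  | last {m : ℕ} {π : Equiv.Perm ℤ} {e : ℤ × ℤ} :
      π ((m : ℤ) + 1) = (m : ℤ) + 1 → PermEdge m π e → PermEdge (m + 1) π e
  | here {m : ℕ} {π : Equiv.Perm ℤ} {j : ℤ} :
      π ((m : ℤ) + 1) ≠ (m : ℤ) + 1 →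
      IsLeast {i : ℤ | 1 ≤ i ∧ π ((m : ℤ) + 1) < π i} j →
      PermEdge (m + 1) π (j, (m : ℤ) + 1)
  | exchange {m : ℕ} {π : Equiv.Perm ℤ} {j : ℤ} {e : ℤ × ℤ} :
      π ((m : ℤ) + 1) ≠ (m : ℤ) + 1 →
      IsLeast {i : ℤ | 1 ≤ i ∧ π ((m : ℤ) + 1) < π i} j →
      PermEdge (m + 1) (π * Equiv.swap j ((m : ℤ) + 1)) e → PermEdge (m + 1) π e

/-- The edge set of the network `N(π)` of a permutation `π` of `{1, …, n}`. -/
def permNetwork (n : ℕ) (π : Equiv.Perm ℤ) : Set (ℤ × ℤ) := {e | PermEdge n π e}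

/-! ### Polyominoes -/

/-- A unit square: its column (numbered from left to right) and its height (increasing upwards). -/
abbrev Cell := ℤ × ℤ

/-- Two unit squares sharing an edge. -/
def Adjacent (a b : Cell) : Prop :=
  (a.1 = b.1 ∧ |a.2 - b.2| = 1) ∨ (a.2 = b.2 ∧ |a.1 - b.1| = 1)

/-- Any two cells of `S` are joined by a chain of adjacent cells inside `S`. -/
def Connected (S : Set Cell) : Prop :=
  ∀ a ∈ S, ∀ b ∈ S, Relation.ReflTransGen (fun u v => Adjacent u v ∧ v ∈ S) a b

/-- The north edges of `P`. The cells whose north (below: south, east) edge lies on the boundary of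
`P` stand for these edges. -/
def northEdges (P : Finset Cell) : Finset Cell := P.filter fun c => (c.1, c.2 + 1) ∉ P

/-- The south edges of `P`. -/
def southEdges (P : Finset Cell) : Finset Cell := P.filter fun c => (c.1, c.2 - 1) ∉ P

/-- The east edges of `P`. -/
def eastEdges (P : Finset Cell) : Finset Cell := P.filter fun c => (c.1 + 1, c.2) ∉ P

/-- The polyominoes under consideration, placed so that the left-most column is column `1`. -/
structure IsAdmissible (P : Finset Cell) : Prop where
  nonempty : P.Nonempty
  connected : Connected (P : Set Cell)
  leftmost : (∀ c ∈ P, 1 ≤ c.1) ∧ ∃ c ∈ P, c.1 = 1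
  noHoles : Connected ((P : Set Cell)ᶜ)
  north : ∀ a ∈ northEdges P, ∀ b ∈ northEdges P, a.1 < b.1 → b.2 ≤ a.2
  south : ∃ k : ℤ,
    (∀ a ∈ southEdges P, ∀ b ∈ southEdges P, a.1 < b.1 → b.1 ≤ k → b.2 ≤ a.2) ∧
    (∀ a ∈ southEdges P, ∀ b ∈ southEdges P, k ≤ a.1 → a.1 < b.1 → a.2 ≤ b.2)

/-! ### The labeling -/

open Classical in
/-- The label of the east edge of `e` starts in the column right to `e`. The `k` rows above `e`
are passed one after the other, from bottom to top, and the label is moved right by a unit for each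
of these rows whose east edge is to the left of the current column of the label.
`labelColumn P e k` is the column reached after `k` rows. -/
noncomputable def labelColumn (P : Finset Cell) (e : Cell) : ℕ → ℤ
  | 0 => e.1 + 1
  | k + 1 =>
    if ∃ f ∈ eastEdges P, f.2 = e.2 + ((k : ℤ) + 1) ∧ f.1 < labelColumn P e k
    then labelColumn P e k + 1 else labelColumn P e k

/-- The label of the east edge of `e`: `j + 1` plus the number of moves, where `j` is the column
of `e` and all rows above `e` have been passed. -/
noncomputable def eastLabel (P : Finset Cell) (e : Cell) : ℤ :=
  labelColumn P e (P.sup fun c => (c.2 - e.2).toNat)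

/-- The set of labels of the east edges. -/
noncomputable def eastLabels (P : Finset Cell) : Finset ℤ := (eastEdges P).image (eastLabel P)

/-- The label of some east edge lies below the south edge of `s`: on its way up it reaches the
column of `s` below `s`, with no unit square between it and `s`. -/
def HasEastLabelBelow (P : Finset Cell) (s : Cell) : Prop :=
  ∃ e ∈ eastEdges P, ∃ k : ℕ, s.1 = labelColumn P e k ∧ s.2 = e.2 + ((k : ℤ) + 1) ∧
    ∀ r : ℤ, e.2 < r → r < s.2 → (s.1, r) ∉ P

open Classical in
/-- The south edges with an integer label of an east edge below them. -/
noncomputable def coveredEdges (P : Finset Cell) : Finset Cell :=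
  (southEdges P).filter (HasEastLabelBelow P)

/-- The remaining south edges. -/
noncomputable def freeEdges (P : Finset Cell) : Finset Cell := southEdges P \ coveredEdges P

/-- The position of the remaining south edge of `s`, counted from left: the columns
`1, 2, …` up to the column of `s` are counted, except those whose south edge has the label of an
east edge below it. (For the polyominoes obtained by deleting ribbons, the columns keep their
numbers in the original polyomino, and a column that has lost all its squares is counted.) -/
noncomputable def southIndex (P : Finset Cell) (s : Cell) : ℤ :=
  s.1 - (((coveredEdges P).filter fun c => c.1 < s.1).card : ℤ)

/-- The label of the remaining south edge at position `i` is the `i`-th smallest positive integer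
that is not the label of an east edge. -/
noncomputable def southLabel (P : Finset Cell) (s : Cell) : ℤ :=
  (Nat.nth (fun k : ℕ => 1 ≤ k ∧ (k : ℤ) ∉ eastLabels P) ((southIndex P s).toNat - 1) : ℕ)

/-- The cells in the lowest row of `P`. -/
def lowestCells (P : Finset Cell) : Finset Cell := P.filter fun c => ∀ b ∈ P, c.2 ≤ b.2

open Classical in
/-- The height at which the label of the remaining south edge of `s` is written: directly below `s`
if `s` is left to the lowest row, and otherwise (the label being moved downward) directly below the
lowest row. -/
noncomputable def southLabelHeight (P : Finset Cell) (s : Cell) : ℤ :=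
  if ∃ c ∈ lowestCells P, c.1 ≤ s.1
  then s.2 - (P.sup fun c => (s.2 - c.2).toNat : ℕ) - 1
  else s.2 - 1

/-- All labels, each as a triple: minus its height, its column, its value. -/
noncomputable def placedLabels (P : Finset Cell) : Finset (ℤ ×ₗ ℤ ×ₗ ℤ) :=
  (eastEdges P).image (fun e => toLex (-e.2, toLex (e.1 + 1, eastLabel P e))) ∪
    (freeEdges P).image
      (fun s => toLex (-southLabelHeight P s, toLex (s.1, southLabel P s)))

/-- The word obtained by reading the labels from left to right in each row, the rows being taken
from top to bottom. -/
noncomputable def readingWord (P : Finset Cell) : List ℤ :=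
  ((placedLabels P).sort (· ≤ ·)).map fun t => (ofLex (ofLex t).2).2

/-! ### Ribbons and Dyck tilings -/

/-- `d` is a Dyck tile with lowest, left-most cell `c`: its cells are the points visited by a Dyck
path starting from `c`, where the letter `D` is read as a step to the right. -/
def IsDyckTile (c : Cell) (d : Finset Cell) : Prop :=
  ∃ w : DyckWord, d = (Finset.range (w.toList.length + 1)).image fun k =>
    (c.1 + ((w.toList.take k).count DyckStep.D : ℤ),
      c.2 + ((w.toList.take k).count DyckStep.U : ℤ))

/-- `c` is the unit square whose east edge has the maximal label. -/
def IsRibbonStart (P : Finset Cell) (c : Cell) : Prop :=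
  c ∈ eastEdges P ∧ ∀ e ∈ eastEdges P, eastLabel P e ≤ eastLabel P c

/-- `c` is the unit square whose south edge is lowest and, among the lowest ones, has the minimal
label. -/
def IsRibbonEnd (P : Finset Cell) (c : Cell) : Prop :=
  c ∈ lowestCells P ∧ ∀ b ∈ lowestCells P, southLabel P c ≤ southLabel P b

open Classical in
/-- The south-most ribbon: the squares along the south-east boundary of `P` between the square with
the maximal east label and the square `cl` with the minimal lowest south label. -/
noncomputable def ribbon (P : Finset Cell) : Finset Cell :=
  P.filter fun c => (c.1 + 1, c.2 - 1) ∉ P ∧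
    ∃ cr cl, IsRibbonStart P cr ∧ IsRibbonEnd P cl ∧ c.2 ≤ cr.2 ∧ cl.1 ≤ c.1

/-- `c` is the lowest, left-most cell of a tile of the maximal Dyck tiling of the ribbon. The tiles
of this tiling are the Dyck tiles contained in the ribbon that are of maximal size, i.e. not
contained in a larger one. -/
def IsTileStart (P : Finset Cell) (c : Cell) : Prop :=
  ∃ d : Finset Cell, IsDyckTile c d ∧
    Maximal (fun t => (∃ b, IsDyckTile b t) ∧ t ⊆ ribbon P) d

/-- The square `s` whose south edge has a label left to the minimal tile label and strictly
below the maximal east label. -/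
def IsLowerLeft (P : Finset Cell) (s : Cell) : Prop :=
  s ∈ freeEdges P ∧
    (∃ t, IsTileStart P t ∧ (∀ u, IsTileStart P u → southLabel P t ≤ southLabel P u) ∧
      s.1 < t.1) ∧
    ∃ cr, IsRibbonStart P cr ∧ southLabelHeight P s < cr.2

/-- The edges `(l, n)`, where `n` is the maximal east label and `l` is the label of the south-most
edge of a Dyck tile or one of the labels singled out by `IsLowerLeft`. -/
def stepEdges (P : Finset Cell) : Set (ℤ × ℤ) :=
  {e | ∃ cr s, IsRibbonStart P cr ∧ (IsTileStart P s ∨ IsLowerLeft P s) ∧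
    e = (southLabel P s, eastLabel P cr)}

open Classical in
/-- The next polyomino: delete the ribbon and the squares singled out by `IsLowerLeft`, then move
the squares weakly below the row of the maximal east label rightward by a unit. -/
noncomputable def reduce (P : Finset Cell) : Finset Cell :=
  (P.filter fun c => c ∉ ribbon P ∧ ¬ IsLowerLeft P c).image fun c =>
    if ∃ cr, IsRibbonStart P cr ∧ c.2 ≤ cr.2 then (c.1 + 1, c.2) else c

/-- The union of the edge sets of all polyominoes in the sequence `P, reduce P, …`. -/
noncomputable def polyominoEdges (P : Finset Cell) : Set (ℤ × ℤ) :=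
  ⋃ i : ℕ, stepEdges (reduce^[i] P)

end PolyNet

/-! Call `v` a record of `π` if `code π v = 0`. A whole round of the sorting procedure for the last
point `M` has a simple description (`exists_round`): the edges into `M` come from the records `v <
M` with `π v > π M`; points with value below `π M` keep value and code; non-records above it keep
their value and lose one from their code; records stay records. This description also yields the
network conditions (`permNetwork_aux`).

On the other side, a polyomino is read as a list of rows from top to bottom, row `i` filling the
columns `l i, …, e i`, where `l` increases weakly and `e` has only dips of depth one (`RowShape`).
The east label of row `i` is `up e i (e i + 1)`, and the increasing map `up e R` enumerates all
other labels. The two sides meet in `Link`: for the inverse `π` of the word, the label of row `i`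
has value `l i + i`, its code is the length of row `i`, and every other point is a record.

Let row `q` carry the maximal label. Its edges come from the labels `up e R x` with `l q ≤ x ≤ e q -
(R - 1 - q)`. For the permutation, the lower bound says that the label is read later
(`position_lt_iff`) and the upper bound that it is smaller (`up_lt_iff`). For the polyomino, the `x`
left of the lowest row come from the squares to the lower left and the others from the Dyck tiles
(`stepEdges_eq`). The reduction removes row `q`, moves every lower row up by one place and cuts off
its first square (`mem_reduce`). Thus `l i + i` is preserved and the length drops by one, which is
the effect of a round (`link_reduce`), and induction on the number of points finishes
(`polyominoEdges_eq_permNetwork`).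

The induction asks for `RowShape` and `Link` alone; connectedness and the first column enter only to
establish these for the given polyomino (`exists_rowShape`, `exists_perm`). -/

namespace PolyNet

/-! ### One round of the procedure producing the network of a permutation -/

/-- The number of the smaller points that `π` sends to the right of `π v`. -/
noncomputable def code (π : Equiv.Perm ℤ) (v : ℤ) : ℕ :=
  ((Finset.Ico 1 v).filter fun j => π v < π j).card

lemma code_eq_zero {π : Equiv.Perm ℤ} {v : ℤ} :
    code π v = 0 ↔ ∀ j, 1 ≤ j → j < v → π j < π v := by
  unfold code
  rw [Finset.card_eq_zero, Finset.filter_eq_empty_iff]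
  constructor
  · intro h j h1 h2
    have h3 := h (Finset.mem_Ico.2 ⟨h1, h2⟩)
    have h4 : π j ≠ π v := fun h => h2.ne (π.injective h)
    omega
  · intro h j hj
    have := h j (Finset.mem_Ico.1 hj).1 (Finset.mem_Ico.1 hj).2
    omega

lemma IsPermutation.mapsTo {n : ℕ} {π : Equiv.Perm ℤ} (h : IsPermutation n π) {v : ℤ}
    (h1 : 1 ≤ v) (h2 : v ≤ n) : 1 ≤ π v ∧ π v ≤ n := by
  by_contra hc
  have h3 : π v ∉ Set.Icc (1 : ℤ) n := fun h => hc h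
  have h4 := π.injective (h _ h3)
  rw [h4] at h3
  exact h3 ⟨h1, h2⟩

lemma IsPermutation.inv {n : ℕ} {π : Equiv.Perm ℤ} (h : IsPermutation n π) :
    IsPermutation n π⁻¹ := by
  intro i hi
  rw [Equiv.Perm.inv_eq_iff_eq]
  exact (h i hi).symm

lemma IsPermutation.pred {m : ℕ} {π : Equiv.Perm ℤ} (h : IsPermutation (m + 1) π)
    (hm : π ((m : ℤ) + 1) = (m : ℤ) + 1) : IsPermutation m π := by
  intro i hi
  by_cases h1 : i = (m : ℤ) + 1
  · rw [h1, hm]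
  · apply h
    rintro ⟨h2, h3⟩
    push_cast at h3
    exact hi ⟨h2, by omega⟩

/-- If no smaller point is sent to the right of the last one, the last point is fixed. -/
lemma IsPermutation.last_fixed {m : ℕ} {π : Equiv.Perm ℤ} (h : IsPermutation (m + 1) π)
    (hm : code π ((m : ℤ) + 1) = 0) : π ((m : ℤ) + 1) = (m : ℤ) + 1 := by
  rw [code_eq_zero] at hm
  have h1 := (h.mapsTo (v := (m : ℤ) + 1) (by omega) (by push_cast; omega)).2
  have h2 := h.inv.mapsTo (v := (m : ℤ) + 1) (by omega) (by push_cast; omega)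
  push_cast at h1 h2
  by_contra hc
  have h3 : π⁻¹ ((m : ℤ) + 1) ≠ (m : ℤ) + 1 := by
    intro h4
    rw [Equiv.Perm.inv_eq_iff_eq] at h4
    exact hc h4.symm
  have h5 := hm _ h2.1 (by omega)
  simp at h5
  omega

lemma permNetwork_zero (π : Equiv.Perm ℤ) : permNetwork 0 π = ∅ := by
  ext e
  constructor
  · intro h
    cases h
  · exact fun h => h.elim

lemma permNetwork_last {m : ℕ} {π : Equiv.Perm ℤ} (hm : π ((m : ℤ) + 1) = (m : ℤ) + 1) :
    permNetwork (m + 1) π = permNetwork m π := by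
  ext e
  constructor
  · intro h
    cases h with
    | last _ h => exact h
    | here h _ => exact absurd hm h
    | exchange h _ _ => exact absurd hm h
  · intro h
    exact PermEdge.last hm h

lemma permNetwork_exchange {m : ℕ} {π : Equiv.Perm ℤ} {j : ℤ}
    (hm : π ((m : ℤ) + 1) ≠ (m : ℤ) + 1)
    (hj : IsLeast {i : ℤ | 1 ≤ i ∧ π ((m : ℤ) + 1) < π i} j) :
    permNetwork (m + 1) π =
      insert (j, (m : ℤ) + 1) (permNetwork (m + 1) (π * Equiv.swap j ((m : ℤ) + 1))) := by
  ext e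
  constructor
  · intro h
    cases h with
    | last h _ => exact absurd h hm
    | here h h2 => exact Or.inl (by rw [h2.unique hj])
    | exchange h h2 h3 =>
      rw [h2.unique hj] at h3
      exact Or.inr h3
  · rintro (h | h)
    · rw [h]
      exact PermEdge.here hm hj
    · exact PermEdge.exchange hm hj h

/-- The edges into `M` recorded in the round for `M`. -/
def roundEdges (M : ℤ) (π : Equiv.Perm ℤ) : Set (ℤ × ℤ) :=
  {e | e.2 = M ∧ 1 ≤ e.1 ∧ e.1 < M ∧ π M < π e.1 ∧ code π e.1 = 0}

/-- The effect of the round for `M` on positions and codes. -/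
structure RoundRel (M : ℤ) (π π' : Equiv.Perm ℤ) : Prop where
  left : ∀ v, 1 ≤ v → v < M → π v < π M → π' v = π v ∧ code π' v = code π v
  right : ∀ v, 1 ≤ v → v < M → π M < π v → code π v ≠ 0 →
    π' v = π v ∧ code π' v + 1 = code π v
  record : ∀ v, 1 ≤ v → v < M → π M < π v → code π v = 0 → code π' v = 0

lemma RoundRel.code_zero {M : ℤ} {π π' : Equiv.Perm ℤ} (h : RoundRel M π π') {v : ℤ}
    (h1 : 1 ≤ v) (h2 : v < M) (h3 : code π v = 0) : code π' v = 0 := by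
  rcases lt_trichotomy (π v) (π M) with h4 | h4 | h4
  · rw [(h.left v h1 h2 h4).2, h3]
  · exact absurd (π.injective h4) h2.ne
  · exact h.record v h1 h2 h4 h3

section swap

variable {M j : ℤ} {π : Equiv.Perm ℤ}

lemma swap_apply_of_ne {v : ℤ} (h1 : v ≠ j) (h2 : v ≠ M) : (π * Equiv.swap j M) v = π v := by
  simp [Equiv.swap_apply_of_ne_of_ne h1 h2]

lemma code_swap_of_iff {v : ℤ} (h1 : v ≠ j) (h2 : v < M)
    (h : j < v → (π v < π j ↔ π v < π M)) : code (π * Equiv.swap j M) v = code π v := by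
  unfold code
  congr 1
  apply Finset.filter_congr
  intro i hi
  rw [Finset.mem_Ico] at hi
  rw [swap_apply_of_ne h1 h2.ne]
  by_cases hij : i = j
  · subst hij
    simp only [Equiv.Perm.coe_mul, Function.comp_apply, Equiv.swap_apply_left]
    exact (h hi.2).symm
  · rw [swap_apply_of_ne hij (by omega)]

lemma code_swap_of_between {v : ℤ} (h0 : 1 ≤ j) (h1 : j < v) (h2 : v < M)
    (h3 : π M < π v) (h4 : π v < π j) : code (π * Equiv.swap j M) v + 1 = code π v := by
  unfold code
  rw [swap_apply_of_ne h1.ne' h2.ne]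
  have : (Finset.Ico 1 v).filter (fun i => π v < π i) =
      insert j ((Finset.Ico 1 v).filter fun i => π v < (π * Equiv.swap j M) i) := by
    ext i
    simp only [Finset.mem_filter, Finset.mem_insert, Finset.mem_Ico]
    by_cases hij : i = j
    · subst hij
      simp [h0, h1, h4]
    · simp only [hij, false_or]
      constructor
      · rintro ⟨ha, hb⟩
        rw [swap_apply_of_ne hij (by omega)]
        exact ⟨ha, hb⟩
      · rintro ⟨ha, hb⟩
        rw [swap_apply_of_ne hij (by omega)] at hb
        exact ⟨ha, hb⟩
  rw [this, Finset.card_insert_of_notMem]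
  have h5 : (π * Equiv.swap j M) j = π M := by simp
  rw [Finset.mem_filter, h5]
  omega

end swap

/-- The first point `j` with value above that of the last point is a record, and after the exchange
the last value is `π j`; so a round runs through the records above the last value in increasing
order. The gap between the last point and its value shrinks with each exchange, and `d` bounds it.
-/
theorem round_exists {m : ℕ} : ∀ (d : ℕ) (π : Equiv.Perm ℤ), IsPermutation (m + 1) π →
    ((m : ℤ) + 1 - π ((m : ℤ) + 1)).toNat ≤ d →
    ∃ π', IsPermutation m π' ∧ RoundRel ((m : ℤ) + 1) π π' ∧
      permNetwork (m + 1) π = roundEdges ((m : ℤ) + 1) π ∪ permNetwork m π' := by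
  have base : ∀ π : Equiv.Perm ℤ, IsPermutation (m + 1) π → π ((m : ℤ) + 1) = (m : ℤ) + 1 →
      ∃ π', IsPermutation m π' ∧ RoundRel ((m : ℤ) + 1) π π' ∧
      permNetwork (m + 1) π = roundEdges ((m : ℤ) + 1) π ∪ permNetwork m π' := by
    intro π hπ hm
    have hle : ∀ v, 1 ≤ v → v < (m : ℤ) + 1 → ¬ (π ((m : ℤ) + 1) < π v) := by
      intro v h1 h2 h3
      have := (hπ.mapsTo h1 (by push_cast; omega)).2
      push_cast at this
      omega
    refine ⟨π, hπ.pred hm, ⟨fun v _ _ _ => ⟨rfl, rfl⟩, ?_, ?_⟩, ?_⟩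
    · exact fun v h1 h2 h3 => absurd h3 (hle v h1 h2)
    · exact fun v h1 h2 h3 => absurd h3 (hle v h1 h2)
    · rw [permNetwork_last hm]
      have : roundEdges ((m : ℤ) + 1) π = ∅ := by
        ext e
        constructor
        · rintro ⟨_, h1, h2, h3, _⟩
          exact absurd h3 (hle _ h1 h2)
        · exact fun h => h.elim
      rw [this, Set.empty_union]
  intro d
  induction d with
  | zero =>
    intro π hπ hd
    apply base π hπ
    have := (hπ.mapsTo (v := (m : ℤ) + 1) (by omega) (by push_cast; omega)).2
    push_cast at this
    omega
  | succ d ih =>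
    intro π hπ hd
    by_cases hm : π ((m : ℤ) + 1) = (m : ℤ) + 1
    · exact base π hπ hm
    set M : ℤ := (m : ℤ) + 1 with hM
    have hMp : 1 ≤ π M ∧ π M ≤ M := by
      have := hπ.mapsTo (v := M) (by omega) (by push_cast; omega)
      push_cast at this
      exact this
    have hne : ∃ i : ℕ, 1 ≤ (i : ℤ) ∧ π M < π i := by
      have h2 := hπ.inv.mapsTo (v := M) (by omega) (by push_cast; omega)
      refine ⟨(π⁻¹ M).toNat, by omega, ?_⟩
      rw [Int.toNat_of_nonneg (by omega)]
      simp
      omega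
    classical
    have hj1 := Nat.find_spec hne
    have hj2 : ∀ i : ℤ, 1 ≤ i → π M < π i → (Nat.find hne : ℤ) ≤ i := by
      intro i h1 h2
      have := Nat.find_min' hne (m := i.toNat)
        (by rw [Int.toNat_of_nonneg (by omega)]; exact ⟨h1, h2⟩)
      omega
    set j : ℤ := (Nat.find hne : ℤ) with hj
    clear_value j
    have hjM : j < M := by
      by_contra hc
      have h1 : j ≠ M := by
        rintro rfl
        omega
      have := hπ j (by rintro ⟨_, h3⟩; push_cast at h3; omega)
      have h2 := hj2 (π⁻¹ M) (by
        have h2 := hπ.inv.mapsTo (v := M) (by omega) (by push_cast; omega)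
        exact h2.1) (by simp; omega)
      have h3 := hπ.inv.mapsTo (v := M) (by omega) (by push_cast; omega)
      push_cast at h3
      omega
    have hleast : IsLeast {i : ℤ | 1 ≤ i ∧ π M < π i} j := ⟨hj1, fun i hi => hj2 i hi.1 hi.2⟩
    set σ := π * Equiv.swap j M with hσ
    have hσM : σ M = π j := by simp [hσ]
    have hσj : σ j = π M := by simp [hσ]
    have hσv : ∀ v, v ≠ j → v ≠ M → σ v = π v := fun v h1 h2 => swap_apply_of_ne h1 h2
    have hσp : IsPermutation (m + 1) σ := by
      intro i hi
      rw [hσv i, hπ i hi]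
      · rintro rfl
        exact hi ⟨hj1.1, by push_cast; omega⟩
      · rintro rfl
        exact hi ⟨by omega, by push_cast; omega⟩
    have hjp := hπ.mapsTo (v := j) hj1.1 (by push_cast; omega)
    push_cast at hjp
    obtain ⟨π', hp', hrel, hnet⟩ := ih σ hσp (by rw [hσM]; omega)
    have hcj : code π j = 0 := by
      rw [code_eq_zero]
      intro i h1 h2
      by_contra hc
      have := hj2 i h1 (by omega)
      omega
    have hcσj : code σ j = 0 := by
      rw [code_eq_zero]
      intro i h1 h2
      rw [hσj, hσv i (by omega) (by omega)]
      by_contra hc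
      have h3 : π i ≠ π M := fun h => by have := π.injective h; omega
      have := hj2 i h1 (by omega)
      omega
    have hclow : ∀ v, v ≠ j → v < M → π v < π M → code σ v = code π v := by
      intro v h1 h2 h3
      apply code_swap_of_iff h1 h2
      intro _
      omega
    have hchigh : ∀ v, v ≠ j → v < M → π j < π v → code σ v = code π v := by
      intro v h1 h2 h3
      apply code_swap_of_iff h1 h2
      intro _
      omega
    have hcmid : ∀ v, 1 ≤ v → v ≠ j → v < M → π M < π v → π v < π j →
        code σ v + 1 = code π v := by
      intro v h0 h1 h2 h3 h4
      have := hj2 v h0 h3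
      exact code_swap_of_between hj1.1 (by omega) h2 h3 h4
    have hnej : ∀ v, v ≠ j → π v ≠ π j := fun v h1 h2 => h1 (π.injective h2)
    refine ⟨π', hp', ⟨?_, ?_, ?_⟩, ?_⟩
    · intro v h1 h2 h3
      have h4 : v ≠ j := by rintro rfl; omega
      have h5 := hrel.left v h1 h2 (by rw [hσM, hσv v h4 h2.ne]; omega)
      rw [h5.1, h5.2, hσv v h4 h2.ne, hclow v h4 h2 h3]
      exact ⟨rfl, rfl⟩
    · intro v h1 h2 h3 hc
      have h4 : v ≠ j := by rintro rfl; exact hc hcj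
      -- If `π v < π j`, this exchange removes the one inversion and `v` is below the last value for
      -- the rest of the round. Otherwise this exchange does not affect its code and the later ones
      -- remove it.
      rcases lt_or_gt_of_ne (hnej v h4) with h6 | h6
      · have h5 := hrel.left v h1 h2 (by rw [hσM, hσv v h4 h2.ne]; omega)
        rw [h5.1, h5.2, hσv v h4 h2.ne]
        exact ⟨rfl, hcmid v h1 h4 h2 h3 h6⟩
      · have h5 := hrel.right v h1 h2 (by rw [hσM, hσv v h4 h2.ne]; omega)
          (by rw [hchigh v h4 h2 h6]; exact hc)
        rw [h5.1, h5.2, hσv v h4 h2.ne]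
        exact ⟨rfl, hchigh v h4 h2 h6⟩
    · intro v h1 h2 h3 hc
      by_cases h4 : v = j
      · rw [h4, (hrel.left j hj1.1 hjM (by rw [hσM, hσj]; exact hj1.2)).2, hcσj]
      · rcases lt_or_gt_of_ne (hnej v h4) with h6 | h6
        · have := hcmid v h1 h4 h2 h3 h6
          omega
        · exact hrel.record v h1 h2 (by rw [hσM, hσv v h4 h2.ne]; omega)
            (by rw [hchigh v h4 h2 h6]; exact hc)
    · rw [permNetwork_exchange hm hleast, hnet, ← Set.insert_union]
      congr 1
      ext ⟨a, b⟩
      simp only [roundEdges, Set.mem_insert_iff, Set.mem_ofPred_eq, Prod.mk.injEq]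
      constructor
      · rintro (⟨rfl, rfl⟩ | ⟨rfl, h1, h2, h3, h4⟩)
        · exact ⟨rfl, hj1.1, hjM, hj1.2, hcj⟩
        · have h5 : a ≠ j := by
            rintro rfl
            rw [hσM, hσj] at h3
            omega
          rw [hσM, hσv a h5 h2.ne] at h3
          rw [hchigh a h5 h2 h3] at h4
          exact ⟨rfl, h1, h2, by omega, h4⟩
      · rintro ⟨rfl, h1, h2, h3, h4⟩
        by_cases h5 : a = j
        · exact Or.inl ⟨h5, rfl⟩
        · right
          rcases lt_or_gt_of_ne (hnej a h5) with h6 | h6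
          · have := hcmid a h1 h5 h2 h3 h6
            omega
          · exact ⟨rfl, h1, h2, by rw [hσM, hσv a h5 h2.ne]; exact h6,
              by rw [hchigh a h5 h2 h6]; exact h4⟩

theorem exists_round {m : ℕ} {π : Equiv.Perm ℤ} (hπ : IsPermutation (m + 1) π) :
    ∃ π', IsPermutation m π' ∧ RoundRel ((m : ℤ) + 1) π π' ∧
      permNetwork (m + 1) π = roundEdges ((m : ℤ) + 1) π ∪ permNetwork m π' :=
  round_exists _ π hπ le_rfl

/-! ### The edges of a permutation form a network -/

/-- The two claims on records pass through the induction because records stay records. The source of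
every edge of the current round is a record, so they imply the source-sink and crossing conditions
for these edges. -/
theorem permNetwork_aux : ∀ (m : ℕ) (π : Equiv.Perm ℤ), IsPermutation m π →
    IsNetwork m (permNetwork m π) ∧
    (∀ i j, 1 ≤ j → code π j = 0 → (i, j) ∉ permNetwork m π) ∧
    (∀ i j k, i < j → j < k → code π j = 0 → (i, k) ∈ permNetwork m π →
      (j, k) ∈ permNetwork m π) := by
  intro m
  induction m with
  | zero =>
    intro π _
    rw [permNetwork_zero]
    exact ⟨⟨fun e h => h.elim, fun _ _ _ h => h.elim, fun _ _ _ _ _ _ _ h => h.elim⟩,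
      fun _ _ _ _ h => h, fun _ _ _ _ _ _ h => h⟩
  | succ m ih =>
    intro π hπ
    obtain ⟨π', hp', hrel, hnet⟩ := exists_round hπ
    obtain ⟨hN, ha, hb⟩ := ih π' hp'
    have hA : ∀ i j, 1 ≤ j → code π j = 0 → (i, j) ∉ permNetwork (m + 1) π := by
      intro i j h1 hc h
      rw [hnet] at h
      rcases h with ⟨h2, h3, h4, h5, h6⟩ | h
      · simp only at h2 h3 h4 h5 h6
        subst h2
        have := code_eq_zero.1 hc i h3 h4
        omega
      · have h2 := (hN.edge _ h).2.2
        simp only at h2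
        exact ha i j h1 (hrel.code_zero h1 (by omega) hc) h
    have hB : ∀ i j k, i < j → j < k → code π j = 0 → (i, k) ∈ permNetwork (m + 1) π →
        (j, k) ∈ permNetwork (m + 1) π := by
      intro i j k hij hjk hc h
      rw [hnet] at h ⊢
      rcases h with ⟨h2, h3, h4, h5, h6⟩ | h
      · left
        simp only at h2 h3 h4 h5 h6
        have := code_eq_zero.1 hc i h3 hij
        exact ⟨h2, by simp only; omega, by simp only; omega, by simp only; omega, hc⟩
      · right
        have h2 := hN.edge _ h
        simp only at h2
        exact hb i j k hij hjk (hrel.code_zero (by omega) (by omega) hc) h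
    refine ⟨⟨?_, ?_, ?_⟩, hA, hB⟩
    · intro e he
      rw [hnet] at he
      rcases he with ⟨h2, h3, h4, h5, h6⟩ | h
      · push_cast
        omega
      · have h2 := hN.edge _ h
        push_cast
        omega
    · intro i j k hij hjk
      have hij' := hij
      rw [hnet] at hij hjk
      rcases hjk with ⟨h2, h3, h4, h5, h6⟩ | hjk
      · exact hA i j h3 h6 hij'
      · have h3 := hN.edge _ hjk
        rcases hij with ⟨h2, _⟩ | hij
        · simp only at h2 h3
          omega
        · exact hN.source_sink i j k hij hjk
    · intro i j k l hij hjk hkl hik hjl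
      have hik' := hik
      rw [hnet] at hik hjl
      rcases hjl with ⟨h2, h3, h4, h5, h6⟩ | hjl
      · exact hB i j k hij hjk h6 hik'
      · have h3 := hN.edge _ hjl
        rcases hik with ⟨h2, _⟩ | hik
        · simp only at h2 h3
          omega
        · rw [hnet]
          exact Or.inr (hN.crossing i j k l hij hjk hkl hik hjl)

theorem isNetwork_permNetwork {m : ℕ} {π : Equiv.Perm ℤ} (hπ : IsPermutation m π) :
    IsNetwork m (permNetwork m π) := (permNetwork_aux m π hπ).1

/-! ### Passing rows -/

/-- The column of a label in column `x` after passing a row whose east edge is in column `a`. -/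
def pass (a x : ℤ) : ℤ := if a < x then x + 1 else x

lemma pass_of_lt {a x : ℤ} (h : a < x) : pass a x = x + 1 := if_pos h
lemma pass_of_le {a x : ℤ} (h : x ≤ a) : pass a x = x := if_neg (by omega)

lemma pass_lt_pass {a x y : ℤ} (h : x < y) : pass a x < pass a y := by
  unfold pass
  split_ifs <;> omega

lemma le_pass (a x : ℤ) : x ≤ pass a x := by
  unfold pass
  split_ifs <;> omega

lemma pass_le (a x : ℤ) : pass a x ≤ x + 1 := by
  unfold pass
  split_ifs <;> omega

/-- Rows are numbered from top to bottom and the row `i` ends in column `e i`. A label that is in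
column `x` when the rows `i - 1, …, 0` are left to be passed finally arrives in column `up e i x`. -/
def up (e : ℕ → ℤ) : ℕ → ℤ → ℤ
  | 0, x => x
  | i + 1, x => up e i (pass (e i) x)

lemma up_strictMono (e : ℕ → ℤ) : ∀ i, StrictMono (up e i)
  | 0 => strictMono_id
  | i + 1 => fun _ _ h => up_strictMono e i (pass_lt_pass h)

lemma up_lt_up {e : ℕ → ℤ} {i : ℕ} {x y : ℤ} : up e i x < up e i y ↔ x < y :=
  (up_strictMono e i).lt_iff_lt

lemma up_le_up {e : ℕ → ℤ} {i : ℕ} {x y : ℤ} : up e i x ≤ up e i y ↔ x ≤ y :=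
  (up_strictMono e i).le_iff_le

lemma up_inj {e : ℕ → ℤ} {i : ℕ} {x y : ℤ} : up e i x = up e i y ↔ x = y :=
  (up_strictMono e i).injective.eq_iff

lemma le_up (e : ℕ → ℤ) : ∀ i x, x ≤ up e i x
  | 0, _ => le_rfl
  | i + 1, x => (le_pass (e i) x).trans (le_up e i _)

lemma up_le (e : ℕ → ℤ) : ∀ i x, up e i x ≤ x + i
  | 0, x => by simp [up]
  | i + 1, x => by
    have := up_le e i (pass (e i) x)
    have := pass_le (e i) x
    simp only [up]
    push_cast
    omega

lemma up_eq_self {e : ℕ → ℤ} : ∀ {i : ℕ} {x : ℤ}, (∀ j < i, x ≤ e j) → up e i x = x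
  | 0, _, _ => rfl
  | i + 1, x, h => by
    rw [up, pass_of_le (h i (by omega)), up_eq_self fun j hj => h j (by omega)]

lemma up_congr {e e' : ℕ → ℤ} : ∀ {i : ℕ}, (∀ j < i, e j = e' j) → ∀ x, up e i x = up e' i x
  | 0, _, _ => rfl
  | i + 1, h, x => by
    rw [up, up, h i (by omega), up_congr fun j hj => h j (by omega)]

/-- Rows that end weakly right of a label do not move it. -/
lemma up_add {e : ℕ → ℤ} {i : ℕ} {x : ℤ} : ∀ {k : ℕ}, (∀ j, i ≤ j → j < i + k → x ≤ e j) →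
    up e (i + k) x = up e i x
  | 0, _ => rfl
  | k + 1, h => by
    rw [← add_assoc, up, pass_of_le (h _ (by omega) (by omega)),
      up_add fun j h1 h2 => h j h1 (by omega)]

lemma up_of_le {e : ℕ → ℤ} {i n : ℕ} {x : ℤ} (hin : i ≤ n)
    (h : ∀ j, i ≤ j → j < n → x ≤ e j) : up e n x = up e i x := by
  obtain ⟨k, rfl⟩ := Nat.exists_eq_add_of_le hin
  exact up_add h

/-- The east label of row `i`. -/
def rowLabel (e : ℕ → ℤ) (i : ℕ) : ℤ := up e i (e i + 1)

lemma rowLabel_congr {e e' : ℕ → ℤ} {i : ℕ} (h : ∀ j ≤ i, e j = e' j) :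
    rowLabel e i = rowLabel e' i := by
  rw [rowLabel, rowLabel, h i le_rfl, up_congr fun j hj => h j hj.le]

lemma rowLabel_le (e : ℕ → ℤ) (i : ℕ) : rowLabel e i ≤ e i + 1 + i := up_le e i _

/-- The labels that do not come from the rows `0, …, i - 1` are the values of `up e i`. -/
lemma exists_up_iff {e : ℕ → ℤ} : ∀ {i : ℕ} {v : ℤ},
    (∃ x, up e i x = v) ↔ ∀ j < i, v ≠ rowLabel e j := by
  intro i
  induction i with
  | zero => intro v; simp [up]
  | succ i ih =>
    intro v
    constructor
    · rintro ⟨x, rfl⟩ j hj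
      rcases Nat.lt_succ_iff_lt_or_eq.1 hj with hj | rfl
      · exact ih.1 ⟨pass (e i) x, rfl⟩ j hj
      · rw [up, rowLabel, Ne, up_inj]
        unfold pass
        split_ifs <;> omega
    · intro h
      obtain ⟨x, rfl⟩ := ih.2 fun j hj => h j (by omega)
      have h1 : x ≠ e i + 1 := by
        rintro rfl
        exact h i (by omega) rfl
      rcases lt_or_gt_of_ne h1 with h2 | h2
      · exact ⟨x, by rw [up, pass_of_le (by omega)]⟩
      · exact ⟨x - 1, by rw [up, pass_of_lt (by omega)]; congr 1; omega⟩

lemma up_ne_rowLabel {e : ℕ → ℤ} {i j : ℕ} (h : j < i) (x : ℤ) : up e i x ≠ rowLabel e j :=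
  exists_up_iff.1 ⟨x, rfl⟩ j h

lemma rowLabel_injective (e : ℕ → ℤ) : Function.Injective (rowLabel e) := by
  intro i j h
  by_contra hc
  rcases lt_or_gt_of_ne hc with h1 | h1
  · exact up_ne_rowLabel h1 (e j + 1) h.symm
  · exact up_ne_rowLabel h1 (e i + 1) h

/-- A row moves a label exactly when the label of the row itself ends up to the left of it, so the
count is the total displacement. -/
lemma card_rowLabel_lt_up {e : ℕ → ℤ} : ∀ (i : ℕ) (x : ℤ),
    (((Finset.range i).filter fun j => rowLabel e j < up e i x).card : ℤ) = up e i x - x := by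
  intro i
  induction i with
  | zero =>
    intro x
    rw [Finset.range_zero, Finset.filter_empty]
    simp [up]
  | succ i ih =>
    intro x
    rw [Finset.range_add_one, Finset.filter_insert, up]
    have h1 := ih (pass (e i) x)
    by_cases h : e i < x
    · rw [if_pos, Finset.card_insert_of_notMem (by simp)]
      · push_cast
        rw [h1, pass_of_lt h]
        omega
      · rw [rowLabel, up_lt_up, pass_of_lt h]
        omega
    · rw [if_neg, h1, pass_of_le (by omega)]
      rw [rowLabel, up_lt_up, pass_of_le (by omega)]
      omega

lemma up_pos_iff {e : ℕ → ℤ} {i : ℕ} {x : ℤ} (he : ∀ j < i, 1 ≤ e j) :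
    1 ≤ up e i x ↔ 1 ≤ x := by
  have h0 : up e i 0 = 0 := up_eq_self fun j hj => by have := he j hj; omega
  have : 0 < up e i x ↔ 0 < x := by
    conv_lhs => rw [← h0]
    exact up_lt_up
  omega

/-! ### Polyominoes given by their rows -/

/-- `P` consists of `R` rows at the heights `h, h - 1, …`, the row `i` extending from column `l i`
to column `e i`. The rows start weakly further to the right from top to bottom, and a row ends left
of rows above and below it only by a unit. -/
structure RowShape (P : Finset Cell) (h : ℤ) (R : ℕ) (l e : ℕ → ℤ) : Prop where
  mem : ∀ c r : ℤ, (c, r) ∈ P ↔ ∃ i < R, r = h - (i : ℤ) ∧ l i ≤ c ∧ c ≤ e i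
  le : ∀ i < R, l i ≤ e i
  mono : ∀ i j, i ≤ j → j < R → l i ≤ l j
  pos : ∀ i < R, 1 ≤ l i
  valley : ∀ i j k, i < j → j < k → k < R → e j < e i → e j < e k →
    e i = e j + 1 ∧ e k = e j + 1

namespace RowShape

variable {P : Finset Cell} {h : ℤ} {R : ℕ} {l e : ℕ → ℤ} (S : RowShape P h R l e)
include S

lemma mem_row {c : ℤ} {i : ℕ} : (c, h - (i : ℤ)) ∈ P ↔ i < R ∧ l i ≤ c ∧ c ≤ e i := by
  rw [S.mem]
  constructor
  · rintro ⟨j, hj, h1, h2⟩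
    obtain rfl : i = j := by omega
    exact ⟨hj, h2⟩
  · rintro ⟨hi, h2⟩
    exact ⟨i, hi, rfl, h2⟩

lemma mem_cell {s : Cell} (hs : s ∈ P) :
    ∃ i < R, s = (s.1, h - (i : ℤ)) ∧ l i ≤ s.1 ∧ s.1 ≤ e i := by
  obtain ⟨c, r⟩ := s
  obtain ⟨i, hi, rfl, h2⟩ := (S.mem c r).1 hs
  exact ⟨i, hi, rfl, h2⟩

lemma one_le_e {i : ℕ} (hi : i < R) : 1 ≤ e i := (S.pos i hi).trans (S.le i hi)

lemma mem_eastEdges {c : Cell} : c ∈ eastEdges P ↔ ∃ i < R, c = (e i, h - (i : ℤ)) := by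
  unfold eastEdges
  rw [Finset.mem_filter]
  constructor
  · rintro ⟨h1, h2⟩
    obtain ⟨i, hi, h3, h4, h5⟩ := S.mem_cell h1
    refine ⟨i, hi, ?_⟩
    have h6 : c.2 = h - (i : ℤ) := by rw [h3]
    rw [h6, S.mem_row] at h2
    rw [h3]
    congr 1
    have := fun h => h2 ⟨hi, h⟩
    omega
  · rintro ⟨i, hi, rfl⟩
    refine ⟨S.mem_row.2 ⟨hi, S.le i hi, le_rfl⟩, ?_⟩
    rw [S.mem_row]
    omega

lemma exists_eastEdge {i k : ℕ} {x : ℤ} :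
    (∃ f ∈ eastEdges P, f.2 = h - (i : ℤ) + ((k : ℤ) + 1) ∧ f.1 < x) ↔
      i < R + (k + 1) ∧ k + 1 ≤ i ∧ e (i - (k + 1)) < x := by
  constructor
  · rintro ⟨f, hf, h1, h2⟩
    obtain ⟨j, hj, rfl⟩ := S.mem_eastEdges.1 hf
    simp only at h1 h2
    obtain rfl : i = j + (k + 1) := by omega
    refine ⟨by omega, by omega, ?_⟩
    rwa [show j + (k + 1) - (k + 1) = j by omega]
  · rintro ⟨h1, h2, h3⟩
    refine ⟨_, S.mem_eastEdges.2 ⟨i - (k + 1), by omega, rfl⟩, ?_, h3⟩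
    simp only
    push_cast [h2]
    omega

omit S in
lemma labelColumn_zero {c : Cell} : labelColumn P c 0 = c.1 + 1 := rfl

lemma labelColumn_succ {i k : ℕ} (hi : i < R) (hk : k < i) :
    labelColumn P (e i, h - (i : ℤ)) (k + 1) =
      pass (e (i - (k + 1))) (labelColumn P (e i, h - (i : ℤ)) k) := by
  simp only [labelColumn, pass]
  have := S.exists_eastEdge (i := i) (k := k) (x := labelColumn P (e i, h - (i : ℤ)) k)
  by_cases h1 : e (i - (k + 1)) < labelColumn P (e i, h - (i : ℤ)) k
  · rw [if_pos (this.2 ⟨by omega, by omega, h1⟩), if_pos h1]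
  · rw [if_neg fun h2 => h1 (this.1 h2).2.2, if_neg h1]

/-- Invariant of the climb: the rows still to be passed carry the current column to the final label.
-/
lemma up_labelColumn {i : ℕ} (hi : i < R) : ∀ {k : ℕ}, k ≤ i →
    up e (i - k) (labelColumn P (e i, h - (i : ℤ)) k) = rowLabel e i := by
  intro k
  induction k with
  | zero => intro _; rfl
  | succ k ih =>
    intro hk
    rw [← ih (by omega), S.labelColumn_succ hi (by omega), show i - k = (i - (k + 1)) + 1 by omega]
    rfl

lemma labelColumn_of_ge {i : ℕ} {k : ℕ} (hi : i < R) (hk : i ≤ k) :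
    labelColumn P (e i, h - (i : ℤ)) k = rowLabel e i := by
  induction k, hk using Nat.le_induction with
  | base => simpa [up] using S.up_labelColumn hi le_rfl
  | succ k hk ih =>
    rw [labelColumn, if_neg, ih]
    rw [S.exists_eastEdge]
    omega

lemma eastLabel_eq {i : ℕ} (hi : i < R) : eastLabel P (e i, h - (i : ℤ)) = rowLabel e i := by
  apply S.labelColumn_of_ge hi
  have h1 : (l 0, h - ((0 : ℕ) : ℤ)) ∈ P :=
    S.mem_row.2 ⟨by omega, le_rfl, S.le 0 (by omega)⟩
  have h2 := Finset.le_sup (f := fun c : Cell => (c.2 - (h - (i : ℤ))).toNat) h1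
  simp only [Nat.cast_zero] at h2 ⊢
  omega

lemma mem_eastLabels {v : ℤ} : v ∈ eastLabels P ↔ ∃ i < R, v = rowLabel e i := by
  unfold eastLabels
  rw [Finset.mem_image]
  constructor
  · rintro ⟨c, hc, rfl⟩
    obtain ⟨i, hi, rfl⟩ := S.mem_eastEdges.1 hc
    exact ⟨i, hi, S.eastLabel_eq hi⟩
  · rintro ⟨i, hi, rfl⟩
    exact ⟨_, S.mem_eastEdges.2 ⟨i, hi, rfl⟩, S.eastLabel_eq hi⟩

/-- The values of `up e R` at positive columns are the positive integers that are not east labels,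
in increasing order. -/
lemma southLabel_eq {s : Cell} (hs : 1 ≤ southIndex P s) :
    southLabel P s = up e R (southIndex P s) := by
  set p : ℕ → Prop := fun k => 1 ≤ k ∧ (k : ℤ) ∉ eastLabels P with hp
  have hpos : ∀ {x : ℤ}, 1 ≤ up e R x ↔ 1 ≤ x := up_pos_iff fun j hj => S.one_le_e hj
  have hpi : ∀ k : ℕ, p k ↔ ∃ x : ℤ, 1 ≤ x ∧ (k : ℤ) = up e R x := by
    intro k
    rw [hp]
    simp only
    rw [S.mem_eastLabels]
    constructor
    · rintro ⟨h1, h2⟩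
      obtain ⟨x, hx⟩ := (exists_up_iff (e := e) (i := R) (v := (k : ℤ))).2 fun j hj h3 =>
        h2 ⟨j, hj, h3⟩
      exact ⟨x, hpos.1 (by rw [hx]; omega), hx.symm⟩
    · rintro ⟨x, hx, h1⟩
      refine ⟨?_, ?_⟩
      · have := hpos.2 hx
        omega
      · rintro ⟨j, hj, h2⟩
        exact up_ne_rowLabel hj x (h1.symm.trans h2)
  classical
  -- `p` holds exactly at the values of `up e R` on positive columns, so the elements below the
  -- value at `n + 1` are those at `1, …, n`. As `Nat.nth` counts from zero, this identifies it with
  -- `up e R`.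
  have hcount : ∀ n : ℕ, Nat.count p (up e R (n + 1)).toNat = n := by
    intro n
    have h1 : (Finset.range (up e R (n + 1)).toNat).filter p =
        (Finset.Icc (1 : ℤ) n).image (fun x => (up e R x).toNat) := by
      ext k
      rw [Finset.mem_filter, Finset.mem_image, hpi, Finset.mem_range]
      constructor
      · rintro ⟨h1, x, hx, h2⟩
        refine ⟨x, Finset.mem_Icc.2 ⟨hx, ?_⟩, by omega⟩
        have : up e R x < up e R (n + 1) := by omega
        rw [up_lt_up] at this
        omega
      · rintro ⟨x, hx, rfl⟩
        rw [Finset.mem_Icc] at hx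
        have h3 := hpos.2 hx.1
        have h4 : up e R x < up e R (n + 1) := by rw [up_lt_up]; omega
        exact ⟨by omega, x, hx.1, by omega⟩
    rw [Nat.count_eq_card_filter_range, h1, Finset.card_image_of_injOn]
    · simp
    · intro x hx y hy hxy
      simp only [Finset.coe_Icc, Set.mem_Icc] at hx hy hxy
      have h3 := hpos.2 hx.1
      have h4 := hpos.2 hy.1
      exact up_inj.1 (by omega : up e R x = up e R y)
  have h1 : 1 ≤ up e R (southIndex P s) := hpos.2 hs
  have h2 := hcount ((southIndex P s).toNat - 1)
  have h3 : (((southIndex P s).toNat - 1 : ℕ) : ℤ) + 1 = southIndex P s := by omega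
  rw [h3] at h2
  unfold southLabel
  rw [← h2]
  have h4 := Nat.nth_count (p := p) (n := (up e R (southIndex P s)).toNat)
    ((hpi _).2 ⟨southIndex P s, hs, by omega⟩)
  rw [h4]
  omega

/-! ### Covered south edges -/

/-- The label of row `j` lies below the south edge of the square in column `x` of row `i`. -/
def _root_.PolyNet.Covers (P : Finset Cell) (h : ℤ) (e : ℕ → ℤ) (j i : ℕ) (x : ℤ) : Prop :=
  i < j ∧ x = labelColumn P (e j, h - (j : ℤ)) (j - i - 1) ∧
    ∀ a : ℕ, i < a → a < j → (x, h - (a : ℤ)) ∉ P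

lemma mem_coveredEdges {i : ℕ} {x : ℤ} :
    (x, h - (i : ℤ)) ∈ coveredEdges P ↔
      (x, h - (i : ℤ)) ∈ southEdges P ∧ ∃ j < R, Covers P h e j i x := by
  classical
  unfold coveredEdges
  rw [Finset.mem_filter]
  refine and_congr_right fun hs => ?_
  constructor
  · rintro ⟨f, hf, k, h1, h2, h3⟩
    obtain ⟨j, hj, rfl⟩ := S.mem_eastEdges.1 hf
    simp only at h1 h2 h3
    obtain rfl : j = i + k + 1 := by omega
    refine ⟨_, hj, by omega, ?_, ?_⟩
    · rw [h1]
      congr 1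
      omega
    · intro a h4 h5
      apply h3 <;> omega
  · rintro ⟨j, hj, h1, h2, h3⟩
    refine ⟨_, S.mem_eastEdges.2 ⟨j, hj, rfl⟩, j - i - 1, h2, ?_, ?_⟩
    · simp only
      omega
    · intro r h4 h5
      simp only at h4 h5
      have := h3 (h - r).toNat (by omega) (by omega)
      rwa [Int.toNat_of_nonneg (by omega), show h - (h - r) = r by omega] at this

omit S in
lemma labelColumn_mono {j : ℕ} : Monotone (labelColumn P (e j, h - (j : ℤ))) := by
  apply monotone_nat_of_le_succ
  intro n
  simp only [labelColumn]
  split_ifs <;> omega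

omit S in
lemma lt_labelColumn {j k : ℕ} : e j < labelColumn P (e j, h - (j : ℤ)) k := by
  have := labelColumn_mono (P := P) (h := h) (e := e) (j := j) (Nat.zero_le k)
  rw [labelColumn_zero] at this
  simp only at this
  omega

/-- The label starts right of row `j`, so `e j < x ≤ e i`. A row `k` below `j` ending right of `x`
would make `j` a dip, and dips have depth one. -/
lemma le_of_covers {i j k : ℕ} {x : ℤ} (hs : (x, h - (i : ℤ)) ∈ P) (hc : Covers P h e j i x)
    (hjk : j ≤ k) (hk : k < R) : e k ≤ x ∧ e j < x := by
  obtain ⟨h1, h2, _⟩ := hc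
  have h3 : e j < x := h2 ▸ lt_labelColumn
  have h4 := S.mem_row.1 hs
  refine ⟨?_, h3⟩
  rcases hjk.eq_or_lt with rfl | hjk
  · omega
  · by_contra hcon
    have := S.valley i j k h1 hjk hk (by omega) (by omega)
    omega

/-- The label of a row lies below at most one south edge. -/
lemma covers_unique {j i i' : ℕ} {x x' : ℤ} (hj : j < R) (hs : (x, h - (i : ℤ)) ∈ P)
    (hs' : (x', h - (i' : ℤ)) ∈ P) (hc : Covers P h e j i x) (hc' : Covers P h e j i' x')
    (hi : i' ≤ i) : i' = i ∧ x' = x := by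
  obtain ⟨h1, h2, h3⟩ := hc
  obtain ⟨h1', h2', h3'⟩ := hc'
  rcases hi.eq_or_lt with rfl | hi
  · exact ⟨rfl, by rw [h2, h2']⟩
  exfalso
  -- In equal columns, the square of row `i` would lie between the label and the upper edge.
  have hx : x < x' := by
    have h4 : x ≤ x' := by
      rw [h2, h2']
      exact labelColumn_mono (by omega)
    rcases h4.eq_or_lt with rfl | h4
    · exact absurd hs (h3' i hi h1)
    · exact h4
  have hm := S.mem_row.1 hs
  have hm' := S.mem_row.1 hs'
  -- From row `i` upward the label stays in column `x`: row `i` reaches `x`, and a row between `i'`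
  -- and `i` ending left of `x` would be a dip, forcing `e i' ≤ x < x'`.
  have key : ∀ k : ℕ, j - i - 1 ≤ k → k ≤ j - i' - 1 →
      labelColumn P (e j, h - (j : ℤ)) k = x := by
    intro k hk
    induction k, hk using Nat.le_induction with
    | base => exact fun _ => h2.symm
    | succ k hk ih =>
      intro hk'
      rw [S.labelColumn_succ hj (by omega), ih (by omega), pass_of_le]
      by_contra hcon
      rcases (show j - (k + 1) ≤ i by omega).eq_or_lt with h4 | h4
      · rw [h4] at hcon
        omega
      · have := S.valley i' (j - (k + 1)) i (by omega) h4 hm.1 (by omega) (by omega)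
        omega
  have := key (j - i' - 1) (by omega) le_rfl
  omega

/-- At most one label lies below a south edge. -/
lemma covers_injective {j j' i : ℕ} {x : ℤ} (hj : j < R) (hj' : j' < R)
    (hc : Covers P h e j i x) (hc' : Covers P h e j' i x) : j = j' := by
  -- Both labels are in column `x` with the same rows left to pass, so they end with the same value.
  apply rowLabel_injective e
  rw [← S.up_labelColumn hj (k := j - i - 1) (by omega),
    ← S.up_labelColumn hj' (k := j' - i - 1) (by omega), ← hc.2.1, ← hc'.2.1]
  have := hc.1
  have := hc'.1
  congr 1
  omega

end RowShape

/-! ### Maximal Dyck tiles in a ribbon -/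

lemma count_U_add_count_D : ∀ w : List DyckStep,
    w.count DyckStep.U + w.count DyckStep.D = w.length
  | [] => rfl
  | DyckStep.U :: w => by
    have := count_U_add_count_D w
    rw [List.count_cons_self, List.count_cons_of_ne (by decide), List.length_cons]
    omega
  | DyckStep.D :: w => by
    have := count_U_add_count_D w
    rw [List.count_cons_self, List.count_cons_of_ne (by decide), List.length_cons]
    omega

/-- `T` is a path of up and right steps whose end is maximal with respect to `column - height`. -/
structure IsPath (T : Finset Cell) : Prop where
  inj : ∀ a ∈ T, ∀ b ∈ T, a.1 + a.2 = b.1 + b.2 → a = b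
  step : ∀ a ∈ T, ∀ b ∈ T, a.1 + a.2 < b.1 + b.2 → (a.1 + 1, a.2) ∈ T ∨ (a.1, a.2 + 1) ∈ T
  last : T.Nonempty → ∃ z ∈ T, ∀ a ∈ T, a.1 + a.2 ≤ z.1 + z.2 ∧ a.1 - a.2 ≤ z.1 - z.2

/-- `column + height` is the time along the path and `column - height` its level: an up step lowers
the level and a right step raises it. A Dyck tile stays weakly below its initial level and returns
to it at the end. -/
lemma IsDyckTile.spec {b : Cell} {d : Finset Cell} (hd : IsDyckTile b d) :
    b ∈ d ∧ (∀ x ∈ d, b.1 + b.2 ≤ x.1 + x.2 ∧ x.1 - x.2 ≤ b.1 - b.2) ∧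
    ∃ f ∈ d, f.1 - f.2 = b.1 - b.2 ∧ (∀ x ∈ d, x.1 + x.2 ≤ f.1 + f.2) ∧
      ∀ t, b.1 + b.2 ≤ t → t ≤ f.1 + f.2 → ∃ x ∈ d, x.1 + x.2 = t := by
  obtain ⟨w, rfl⟩ := hd
  have hsum : ∀ k ≤ w.toList.length,
      ((w.toList.take k).count DyckStep.U : ℤ) + (w.toList.take k).count DyckStep.D = k := by
    intro k hk
    have := count_U_add_count_D (w.toList.take k)
    rw [List.length_take_of_le hk] at this
    exact_mod_cast this
  have hle : ∀ k, ((w.toList.take k).count DyckStep.D : ℤ) ≤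
      (w.toList.take k).count DyckStep.U := by
    intro k
    exact_mod_cast w.count_D_le_count_U k
  have hend := w.count_U_eq_count_D
  have hlen := hsum _ le_rfl
  rw [List.take_length] at hlen
  refine ⟨Finset.mem_image.2 ⟨0, by simp, by simp⟩, ?_, ?_⟩
  · intro x hx
    obtain ⟨k, hk, rfl⟩ := Finset.mem_image.1 hx
    have := hle k
    simp only
    omega
  · refine ⟨_, Finset.mem_image.2 ⟨w.toList.length, by simp, rfl⟩, ?_, ?_, ?_⟩
    · simp only [List.take_length]
      omega
    · intro x hx
      obtain ⟨k, hk, rfl⟩ := Finset.mem_image.1 hx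
      rw [Finset.mem_range] at hk
      have := hsum k (by omega)
      simp only [List.take_length]
      omega
    · intro t h1 h2
      simp only [List.take_length] at h2
      refine ⟨_, Finset.mem_image.2 ⟨(t - (b.1 + b.2)).toNat, ?_, rfl⟩, ?_⟩
      · rw [Finset.mem_range]
        omega
      · have := hsum (t - (b.1 + b.2)).toNat (by omega)
        simp only
        omega

namespace IsPath

variable {T : Finset Cell} (hT : IsPath T)
include hT

lemma successor {a c : Cell} (ha : a ∈ T) (hc : c ∈ T) (h : c.1 + c.2 = a.1 + a.2 + 1) :
    c = (a.1 + 1, a.2) ∨ c = (a.1, a.2 + 1) := by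
  rcases hT.step a ha c hc (by omega) with h1 | h1
  · exact Or.inl (hT.inj c hc _ h1 (by simp only; omega))
  · exact Or.inr (hT.inj c hc _ h1 (by simp only; omega))

omit hT in
open Classical in
/-- The next step of the path. -/
noncomputable def _root_.PolyNet.nextStep (T : Finset Cell) (c : Cell) : DyckStep :=
  if (c.1, c.2 + 1) ∈ T then DyckStep.U else DyckStep.D

omit hT in
/-- The square reached after `k` steps from `b`. -/
noncomputable def _root_.PolyNet.walk (T : Finset Cell) (b : Cell) : ℕ → Cell
  | 0 => b
  | k + 1 => if nextStep T (walk T b k) = DyckStep.U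
      then ((walk T b k).1, (walk T b k).2 + 1) else ((walk T b k).1 + 1, (walk T b k).2)

lemma walk_mem {b g : Cell} (hb : b ∈ T) (hg : g ∈ T) : ∀ k : ℕ,
    b.1 + b.2 + k ≤ g.1 + g.2 →
    walk T b k ∈ T ∧ (walk T b k).1 + (walk T b k).2 = b.1 + b.2 + k := by
  intro k
  induction k with
  | zero => exact fun _ => ⟨hb, by simp [walk]⟩
  | succ k ih =>
    intro hk
    push_cast at hk
    obtain ⟨h1, h2⟩ := ih (by omega)
    simp only [walk, nextStep]
    by_cases h3 : ((walk T b k).1, (walk T b k).2 + 1) ∈ T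
    · simp only [h3, if_true]
      refine ⟨trivial, ?_⟩
      push_cast
      omega
    · simp only [h3, if_false, reduceCtorEq]
      rcases hT.step _ h1 g hg (by omega) with h4 | h4
      · refine ⟨h4, ?_⟩
        push_cast
        omega
      · exact absurd h4 h3

lemma exists_between {b g : Cell} (hb : b ∈ T) (hg : g ∈ T) {t : ℤ} (h1 : b.1 + b.2 ≤ t)
    (h2 : t ≤ g.1 + g.2) : ∃ x ∈ T, x.1 + x.2 = t := by
  have := hT.walk_mem hb hg (t - (b.1 + b.2)).toNat (by omega)
  exact ⟨_, this.1, by omega⟩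

omit hT in
lemma count_walk (b : Cell) (n : ℕ) :
    (walk T b n).1 =
      b.1 + (((List.range n).map fun k => nextStep T (walk T b k)).count DyckStep.D : ℤ) ∧
    (walk T b n).2 =
      b.2 + (((List.range n).map fun k => nextStep T (walk T b k)).count DyckStep.U : ℤ) := by
  induction n with
  | zero => simp [walk]
  | succ n ih =>
    rw [List.range_succ, List.map_append, List.count_append, List.count_append]
    simp only [walk, List.map_cons, List.map_nil]
    cases h : nextStep T (walk T b n)
    · simp [ih.1, ih.2, add_assoc]
    · simp [ih.1, ih.2, add_assoc]

/-- The steps from `b` to `g` are read as a word; `h2` makes it balanced and `h3` is the condition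
on its initial parts. -/
lemma isDyckTile {b g : Cell} (hb : b ∈ T) (hg : g ∈ T) (h1 : b.1 + b.2 ≤ g.1 + g.2)
    (h2 : g.1 - g.2 = b.1 - b.2)
    (h3 : ∀ x ∈ T, b.1 + b.2 ≤ x.1 + x.2 → x.1 + x.2 ≤ g.1 + g.2 → x.1 - x.2 ≤ b.1 - b.2) :
    IsDyckTile b (T.filter fun x => b.1 + b.2 ≤ x.1 + x.2 ∧ x.1 + x.2 ≤ g.1 + g.2) := by
  set n := (g.1 + g.2 - (b.1 + b.2)).toNat with hn
  have hmem := fun k (hk : k ≤ n) => hT.walk_mem hb hg k (by omega)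
  have hwn : walk T b n = g := hT.inj _ (hmem n le_rfl).1 g hg (by
    rw [(hmem n le_rfl).2]
    omega)
  set w := (List.range n).map fun k => nextStep T (walk T b k) with hw
  have htake : ∀ k, w.take k = (List.range (min k n)).map fun k => nextStep T (walk T b k) := by
    intro k
    rw [hw, ← List.map_take, List.take_range]
  have hc := count_walk (T := T) b
  refine ⟨⟨w, ?_, ?_⟩, ?_⟩
  · have := hc n
    rw [hwn, ← hw] at this
    omega
  · intro k
    rw [htake]
    have h4 := hc (min k n)
    obtain ⟨h5, h6⟩ := hmem (min k n) (by omega)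
    have := h3 _ h5 (by omega) (by omega)
    omega
  · ext x
    simp only
    rw [Finset.mem_filter, Finset.mem_image]
    have hl : w.length = n := by simp [hw]
    rw [hl]
    have hcell : ∀ k ≤ n, (b.1 + ((w.take k).count DyckStep.D : ℤ),
        b.2 + ((w.take k).count DyckStep.U : ℤ)) = walk T b k := by
      intro k hk
      rw [htake, min_eq_left hk]
      exact Prod.ext (hc k).1.symm (hc k).2.symm
    constructor
    · rintro ⟨hx, h4, h5⟩
      have h6 := hmem (x.1 + x.2 - (b.1 + b.2)).toNat (by omega)
      refine ⟨(x.1 + x.2 - (b.1 + b.2)).toNat, Finset.mem_range.2 (by omega), ?_⟩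
      rw [hcell _ (by omega)]
      exact hT.inj _ h6.1 x hx (by omega)
    · rintro ⟨k, hk, rfl⟩
      rw [Finset.mem_range] at hk
      rw [hcell _ (by omega)]
      have h6 := hmem k (by omega)
      exact ⟨h6.1, by omega, by omega⟩

/-- The maximal Dyck tiles of a path start where `column - height` exceeds all earlier values. -/
theorem exists_maximal_iff {s : Cell} :
    (∃ d : Finset Cell, IsDyckTile s d ∧ Maximal (fun t => (∃ b, IsDyckTile b t) ∧ t ⊆ T) d) ↔
      s ∈ T ∧ ∀ b ∈ T, b.1 + b.2 < s.1 + s.2 → b.1 - b.2 < s.1 - s.2 := by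
  constructor
  · rintro ⟨d, hd, ⟨_, hdT⟩, hmax⟩
    obtain ⟨hsd, hd1, f, hf, hfs, hfmax, hdt⟩ := hd.spec
    refine ⟨hdT hsd, ?_⟩
    by_contra hcon
    push Not at hcon
    obtain ⟨b₀, hb₀, h1, h2⟩ := hcon
    -- The tile can be extended: `b` is the last square before `s` of level at least that of `s`,
    -- and `g` will be the first square from the end `f` of the tile on that reaches the level of
    -- `b`. It exists because the level is maximal at the end of the path.
    obtain ⟨b, hb, hbmax⟩ := Finset.exists_max_image
      (T.filter fun b => b.1 + b.2 < s.1 + s.2 ∧ s.1 - s.2 ≤ b.1 - b.2) (fun b => b.1 + b.2)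
      ⟨b₀, Finset.mem_filter.2 ⟨hb₀, h1, h2⟩⟩
    rw [Finset.mem_filter] at hb
    obtain ⟨hbT, hb1, hb2⟩ := hb
    obtain ⟨z, hz, hzmax⟩ := hT.last ⟨_, hbT⟩
    obtain ⟨g, hg, hgmin⟩ := Finset.exists_min_image
      (T.filter fun g => f.1 + f.2 ≤ g.1 + g.2 ∧ b.1 - b.2 ≤ g.1 - g.2) (fun g => g.1 + g.2)
      ⟨z, Finset.mem_filter.2 ⟨hz, (hzmax f (hdT hf)).1, (hzmax b hbT).2⟩⟩
    rw [Finset.mem_filter] at hg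
    obtain ⟨hgT, hg1, hg2⟩ := hg
    have hsf := hfmax s hsd
    -- The level changes by one in each step, so it is attained exactly.
    have hgb : g.1 - g.2 = b.1 - b.2 := by
      rcases hg1.eq_or_lt with h3 | h3
      · have := hT.inj _ (hdT hf) _ hgT h3
        subst this
        omega
      · obtain ⟨p, hp, hpt⟩ := hT.exists_between (hdT hf) hgT (t := g.1 + g.2 - 1)
          (by omega) (by omega)
        have h4 : p.1 - p.2 < b.1 - b.2 := by
          by_contra h5
          have := hgmin p (Finset.mem_filter.2 ⟨hp, by omega, by omega⟩)
          omega
        rcases hT.successor hp hgT (by omega) with h5 | h5 <;>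
        · have h6 := congrArg Prod.fst h5
          have h7 := congrArg Prod.snd h5
          simp only at h6 h7
          omega
    have htile := hT.isDyckTile hbT hgT (by omega) hgb (by
      intro x hx h3 h4
      rcases lt_or_ge (x.1 + x.2) (s.1 + s.2) with h5 | h5
      · by_contra h6
        have h7 := hbmax x (Finset.mem_filter.2 ⟨hx, h5, by omega⟩)
        have := hT.inj x hx b hbT (by omega)
        subst this
        omega
      · rcases le_or_gt (x.1 + x.2) (f.1 + f.2) with h6 | h6
        · obtain ⟨y, hy, hyx⟩ := hdt _ h5 h6
          have := hT.inj y (hdT hy) x hx hyx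
          subst this
          have := (hd1 y hy).2
          omega
        · by_contra h7
          have h8 := hgmin x (Finset.mem_filter.2 ⟨hx, by omega, by omega⟩)
          have := hT.inj x hx g hgT (by omega)
          subst this
          omega)
    have h3 := hmax ⟨⟨b, htile⟩, Finset.filter_subset _ _⟩ (by
      intro x hx
      have h4 := hd1 x hx
      have h5 := hfmax x hx
      exact Finset.mem_filter.2 ⟨hdT hx, by omega, by omega⟩)
    have h4 := (hd1 b (h3 htile.spec.1)).1
    omega
  · rintro ⟨hs, hrec⟩
    classical
    obtain ⟨d, hd, hdmax⟩ := Finset.exists_max_image (T.powerset.filter (IsDyckTile s))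
      Finset.card ⟨_, Finset.mem_filter.2 ⟨Finset.mem_powerset.2 (Finset.filter_subset _ _),
        hT.isDyckTile hs hs le_rfl rfl (by
          intro x hx h1 h2
          have := hT.inj x hx s hs (by omega)
          subst this
          exact le_rfl)⟩⟩
    rw [Finset.mem_filter, Finset.mem_powerset] at hd
    refine ⟨d, hd.2, ⟨⟨s, hd.2⟩, hd.1⟩, ?_⟩
    rintro t ⟨⟨b, hb⟩, htT⟩ hdt
    obtain ⟨hbt, ht1, _⟩ := hb.spec
    have h1 := ht1 s (hdt hd.2.spec.1)
    -- A Dyck tile containing `s` starts no later than `s` and at a level at least that of `s`.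
    have h2 : b = s := by
      by_contra h3
      have h4 : b.1 + b.2 ≠ s.1 + s.2 := fun h => h3 (hT.inj b (htT hbt) s hs h)
      have := hrec b (htT hbt) (by omega)
      omega
    subst h2
    exact (Finset.eq_of_subset_of_card_le hdt
      (hdmax t (Finset.mem_filter.2 ⟨Finset.mem_powerset.2 htT, hb⟩))).ge

end IsPath

/-! ### The row with the maximal label -/

/-- Row `q` is the top-most one among the rows `i < R` with `e i + i` maximal. -/
structure IsTopRow (R : ℕ) (e : ℕ → ℤ) (q : ℕ) : Prop where
  lt : q < R
  before : ∀ j < q, e j + j < e q + q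
  le : ∀ j < R, e j + j ≤ e q + q

lemma exists_isTopRow {R : ℕ} (e : ℕ → ℤ) (hR : 0 < R) : ∃ q, IsTopRow R e q := by
  classical
  have hex : ∃ q, q < R ∧ ∀ j < R, e j + (j : ℤ) ≤ e q + q := by
    obtain ⟨q, hq, hmax⟩ := Finset.exists_max_image (Finset.range R) (fun j => e j + (j : ℤ))
      ⟨0, Finset.mem_range.2 hR⟩
    exact ⟨q, Finset.mem_range.1 hq, fun j hj => hmax j (Finset.mem_range.2 hj)⟩
  have hs := Nat.find_spec hex
  refine ⟨Nat.find hex, hs.1, ?_, hs.2⟩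
  intro j hj
  by_contra hc
  exact Nat.find_min hex hj ⟨by omega, fun k hk => (hs.2 k hk).trans (by omega)⟩

lemma up_eq_add {e : ℕ → ℤ} : ∀ {i : ℕ} {x : ℤ}, (∀ j < i, e j + j + 1 < x + i) →
    up e i x = x + i
  | 0, x, _ => by simp [up]
  | i + 1, x, h => by
    have h1 := h i (by omega)
    push_cast at h1
    rw [up, pass_of_lt (by omega), up_eq_add]
    · push_cast
      omega
    · intro j hj
      have := h j (by omega)
      push_cast at this
      omega

namespace IsTopRow

variable {R q : ℕ} {e : ℕ → ℤ} (hq : IsTopRow R e q)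
include hq

lemma rowLabel_eq : rowLabel e q = e q + 1 + q := by
  apply up_eq_add
  intro j hj
  have := hq.before j hj
  omega

lemma rowLabel_le {j : ℕ} (hj : j < R) : rowLabel e j ≤ rowLabel e q := by
  have := PolyNet.rowLabel_le e j
  have := hq.le j hj
  rw [hq.rowLabel_eq]
  omega

/-- The number of labels left of the maximal east label, apart from the east labels. -/
lemma up_lt_iff {n : ℕ} (h1 : q ≤ n) (h2 : n < R) : ∀ {x : ℤ},
    up e (n + 1) x < rowLabel e q ↔ x ≤ e q - (n - q) := by
  induction n, h1 using Nat.le_induction with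
  | base =>
    intro x
    rw [up, rowLabel, up_lt_up]
    unfold pass
    split_ifs <;> omega
  | succ n h1 ih =>
    intro x
    rw [up, ih (by omega)]
    -- Row `n + 1` ends weakly left of column `e q - (n + 1 - q)`, so it moves every label beyond
    -- that column, and the bound drops by exactly one per row.
    have := hq.le (n + 1) h2
    push_cast at this ⊢
    unfold pass
    split_ifs <;> omega

end IsTopRow

namespace RowShape

variable {P : Finset Cell} {h : ℤ} {R q : ℕ} {l e : ℕ → ℤ} (S : RowShape P h R l e)
include S

lemma isRibbonStart_iff (hq : IsTopRow R e q) {c : Cell} :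
    IsRibbonStart P c ↔ c = (e q, h - (q : ℤ)) := by
  unfold IsRibbonStart
  constructor
  · rintro ⟨h1, h2⟩
    obtain ⟨i, hi, rfl⟩ := S.mem_eastEdges.1 h1
    have h3 := h2 _ (S.mem_eastEdges.2 ⟨q, hq.lt, rfl⟩)
    rw [S.eastLabel_eq hi, S.eastLabel_eq hq.lt] at h3
    rw [rowLabel_injective e (le_antisymm (hq.rowLabel_le hi) h3)]
  · rintro rfl
    refine ⟨S.mem_eastEdges.2 ⟨q, hq.lt, rfl⟩, ?_⟩
    intro f hf
    obtain ⟨i, hi, rfl⟩ := S.mem_eastEdges.1 hf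
    rw [S.eastLabel_eq hi, S.eastLabel_eq hq.lt]
    exact hq.rowLabel_le hi

/-- Below the row of the maximal label the rows get shorter on the right. -/
lemma e_anti (hq : IsTopRow R e q) {i j : ℕ} (h1 : q ≤ i) (h2 : i ≤ j) (h3 : j < R) :
    e j ≤ e i := by
  have hj := hq.le j h3
  rcases h2.eq_or_lt with rfl | h2
  · exact le_rfl
  rcases h1.eq_or_lt with rfl | h1
  · omega
  -- Otherwise row `i` is a dip between `q` and `j`, so `e j = e q`, against the maximality of `e q
  -- + q`.
  by_contra hc
  have := S.valley q i j h1 h2 h3 (by omega) (by omega)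
  omega

omit S in
lemma _root_.PolyNet.southEdges_subset : southEdges P ⊆ P := by
  unfold southEdges
  exact Finset.filter_subset _ _

omit S in
lemma _root_.PolyNet.freeEdges_subset : freeEdges P ⊆ P := by
  unfold freeEdges
  exact Finset.sdiff_subset.trans southEdges_subset

/-! ### South edges, the lowest row and the count of covered edges -/

lemma southEdge_iff {c : ℤ} {i : ℕ} : (c, h - (i : ℤ)) ∈ southEdges P ↔
    (i < R ∧ l i ≤ c ∧ c ≤ e i) ∧ ¬ (i + 1 < R ∧ l (i + 1) ≤ c ∧ c ≤ e (i + 1)) := by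
  unfold southEdges
  rw [Finset.mem_filter, S.mem_row]
  refine and_congr_right fun _ => not_congr ?_
  rw [← S.mem_row]
  push_cast
  rw [show h - ((i : ℤ) + 1) = h - i - 1 by ring]

lemma mem_lowestCells {c : Cell} : c ∈ lowestCells P ↔
    0 < R ∧ l (R - 1) ≤ c.1 ∧ c.1 ≤ e (R - 1) ∧ c.2 = h - ((R - 1 : ℕ) : ℤ) := by
  unfold lowestCells
  rw [Finset.mem_filter]
  constructor
  · rintro ⟨h1, h2⟩
    obtain ⟨i, hi, h3, h4, h5⟩ := S.mem_cell h1
    have h6 := h2 _ (S.mem_row.2 ⟨by omega, le_rfl, S.le (R - 1) (by omega)⟩)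
    rw [h3] at h6
    simp only at h6
    obtain rfl : i = R - 1 := by omega
    exact ⟨by omega, h4, h5, by rw [h3]⟩
  · rintro ⟨hR, h1, h2, h3⟩
    obtain ⟨x, y⟩ := c
    simp only at h1 h2 h3
    subst h3
    refine ⟨S.mem_row.2 ⟨by omega, h1, h2⟩, ?_⟩
    intro b hb
    obtain ⟨i, hi, h3, h4, h5⟩ := S.mem_cell hb
    rw [h3]
    simp only
    omega

/-- Covered edges lie weakly right of the end of the lowest row, so none is subtracted. -/
lemma southIndex_of_le (hR : 0 < R) {c : Cell} (hc : c.1 ≤ e (R - 1)) :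
    southIndex P c = c.1 := by
  unfold southIndex
  rw [Finset.filter_eq_empty_iff.2, Finset.card_empty, Nat.cast_zero, sub_zero]
  intro s hs h1
  have hsP : s ∈ P := by
    classical
    unfold coveredEdges at hs
    exact southEdges_subset (Finset.mem_filter.1 hs).1
  obtain ⟨i, hi, h3, _⟩ := S.mem_cell hsP
  rw [h3] at hs hsP
  obtain ⟨_, j, hj, hcov⟩ := S.mem_coveredEdges.1 hs
  have := S.le_of_covers hsP hcov (k := R - 1) (by omega) (by omega)
  omega

/-- The label of a row below the row `i` covers a south edge left of column `c`, if `(c, i)` is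
further to the south-east than the ends of all rows below it. -/
lemma exists_covers (hq : IsTopRow R e q) {i j : ℕ} {c : ℤ} (hqi : q ≤ i) (hij : i < j)
    (hj : j < R) (hci : c ≤ e i) (hcj : e j + j < c + i) :
    ∃ (a : ℕ) (x : ℤ), x < c ∧ (x, h - (a : ℤ)) ∈ southEdges P ∧ Covers P h e j a x := by
  classical
  set col := labelColumn P (e j, h - (j : ℤ)) with hcol
  have hrun : ∀ k, k ≤ j - i - 1 → (∀ k' < k, e (j - k' - 1) < col k') →
      col k = e j + 1 + k := by
    intro k
    induction k with
    | zero => intro _ _; simp [hcol, labelColumn_zero]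
    | succ k ih =>
      intro hk hlt
      have h1 := hlt k (by omega)
      rw [hcol, S.labelColumn_succ hj (by omega), ← hcol, pass_of_lt (by exact h1),
        ih (by omega) fun k' hk' => hlt k' (by omega)]
      push_cast
      ring
  -- Moved by every row, the label would be in column `e j + j - i < c ≤ e i` directly below row
  -- `i`. So some row, `i` at the latest, reaches over it; the first such row provides the covered
  -- edge.
  have hex : ∃ k, k ≤ j - i - 1 ∧ col k ≤ e (j - k - 1) := by
    by_contra hcon
    push Not at hcon
    have h1 := hrun (j - i - 1) le_rfl fun k' hk' => hcon k' (by omega)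
    have h2 := hcon (j - i - 1) le_rfl
    rw [show j - (j - i - 1) - 1 = i by omega, h1] at h2
    omega
  obtain ⟨hk1, hk2⟩ := Nat.find_spec hex
  have hmin : ∀ k' < Nat.find hex, e (j - k' - 1) < col k' := by
    intro k' hk'
    by_contra hc
    exact Nat.find_min hex hk' ⟨by omega, by omega⟩
  set k := Nat.find hex
  have hk3 := hrun k hk1 hmin
  have hbelow : e (j - k) < col k := by
    rcases Nat.eq_zero_or_pos k with h1 | h1
    · rw [h1] at hk3 ⊢
      simp only [Nat.sub_zero]
      omega
    · have h2 := hmin (k - 1) (by omega)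
      rw [show j - (k - 1) - 1 = j - k by omega] at h2
      exact h2.trans_le (labelColumn_mono (by omega))
  refine ⟨j - k - 1, col k, by omega, ?_, by omega, ?_, ?_⟩
  · rw [S.southEdge_iff]
    refine ⟨⟨by omega, ?_, hk2⟩, ?_⟩
    · have := S.mono (j - k - 1) j (by omega) hj
      have := S.le j hj
      omega
    · rw [show j - k - 1 + 1 = j - k by omega]
      omega
  · rw [← hcol]
    congr 1
    omega
  · intro b hb1 hb2
    rw [S.mem_row]
    have := S.e_anti hq (i := j - k) (j := b) (by omega) (by omega) (by omega)
    omega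

/-- The covered edges left of `c` correspond bijectively to the rows below `i`: each of these covers
one by `exists_covers`, the correspondence is one-to-one by `covers_unique` and `covers_injective`,
and by `le_of_covers` the label of row `i` or of a row above it covers nothing left of `e i`. -/
lemma southIndex_eq (hq : IsTopRow R e q) {i : ℕ} {c : ℤ} (hqi : q ≤ i) (hi : i < R)
    (hci : c ≤ e i) (hrec : ∀ j, i < j → j < R → e j + j < c + i) :
    southIndex P (c, h - (i : ℤ)) = c - ((R : ℤ) - 1 - i) := by
  classical
  have hmem : ∀ s, s ∈ (coveredEdges P).filter (fun s => s.1 < c) ↔ ∃ (a : ℕ) (x : ℤ),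
      s = (x, h - (a : ℤ)) ∧ x < c ∧ (x, h - (a : ℤ)) ∈ southEdges P ∧
        ∃ j < R, Covers P h e j a x := by
    intro s
    rw [Finset.mem_filter]
    constructor
    · rintro ⟨hs, h1⟩
      have hsP : s ∈ P := by
        unfold coveredEdges at hs
        exact southEdges_subset (Finset.mem_filter.1 hs).1
      obtain ⟨a, ha, h3, _⟩ := S.mem_cell hsP
      rw [h3] at hs
      exact ⟨a, s.1, h3, h1, S.mem_coveredEdges.1 hs⟩
    · rintro ⟨a, x, rfl, h1, h2⟩
      exact ⟨S.mem_coveredEdges.2 h2, h1⟩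
  have hcard : ((coveredEdges P).filter fun s => s.1 < c).card = (Finset.Ioo i R).card := by
    apply le_antisymm
    · apply Finset.card_le_card_of_forall_subsingleton
        (fun s j => ∃ (a : ℕ) (x : ℤ), s = (x, h - (a : ℤ)) ∧ Covers P h e j a x)
      · intro s hs
        obtain ⟨a, x, rfl, h1, h2, j, hj, h3⟩ := (hmem s).1 hs
        refine ⟨j, Finset.mem_Ioo.2 ⟨?_, hj⟩, a, x, rfl, h3⟩
        by_contra hc
        have := S.le_of_covers (southEdges_subset h2) h3 (k := i) (by omega) hi
        omega
      · rintro j hj s ⟨hs, a, x, rfl, h3⟩ s' ⟨hs', a', x', rfl, h3'⟩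
        have h4 := Finset.mem_Ioo.1 hj
        obtain ⟨_, _, h5, _, h6, _⟩ := (hmem _).1 hs
        obtain ⟨_, _, h5', _, h6', _⟩ := (hmem _).1 hs'
        rw [← h5] at h6
        rw [← h5'] at h6'
        rcases le_total a a' with h7 | h7
        · obtain ⟨rfl, rfl⟩ := S.covers_unique h4.2 (southEdges_subset h6') (southEdges_subset h6) h3' h3 h7
          rfl
        · obtain ⟨rfl, rfl⟩ := S.covers_unique h4.2 (southEdges_subset h6) (southEdges_subset h6') h3 h3' h7
          rfl
    · apply Finset.card_le_card_of_forall_subsingleton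
        (fun j s => ∃ (a : ℕ) (x : ℤ), s = (x, h - (a : ℤ)) ∧ Covers P h e j a x)
      · intro j hj
        have h4 := Finset.mem_Ioo.1 hj
        obtain ⟨a, x, h1, h2, h3⟩ := S.exists_covers hq hqi h4.1 h4.2 hci (hrec j h4.1 h4.2)
        exact ⟨_, (hmem _).2 ⟨a, x, rfl, h1, h2, j, h4.2, h3⟩, a, x, rfl, h3⟩
      · rintro s hs j ⟨hj, a, x, rfl, h3⟩ j' ⟨hj', a', x', h5, h3'⟩
        have h6 := congrArg Prod.fst h5
        have h7 := congrArg Prod.snd h5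
        simp only at h6 h7
        subst h6
        obtain rfl : a = a' := by omega
        exact S.covers_injective (Finset.mem_Ioo.1 hj).2 (Finset.mem_Ioo.1 hj').2 h3 h3'
  unfold southIndex
  simp only
  rw [hcard, Nat.card_Ioo]
  omega

/-! ### The ribbon -/

lemma isRibbonEnd_iff (hR : 0 < R) {c : Cell} :
    IsRibbonEnd P c ↔ c = (l (R - 1), h - ((R - 1 : ℕ) : ℤ)) := by
  unfold IsRibbonEnd
  have hlab : ∀ b ∈ lowestCells P, southLabel P b = up e R b.1 := by
    intro b hb
    rw [S.mem_lowestCells] at hb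
    have h1 := S.southIndex_of_le hR hb.2.2.1
    have := S.pos (R - 1) (by omega)
    rw [S.southLabel_eq (by omega), h1]
  have hlow : ((l (R - 1), h - ((R - 1 : ℕ) : ℤ)) : Cell) ∈ lowestCells P :=
    S.mem_lowestCells.2 ⟨hR, le_rfl, S.le _ (by omega), rfl⟩
  constructor
  · rintro ⟨h1, h2⟩
    have h3 := h2 _ hlow
    rw [hlab _ h1, hlab _ hlow, up_le_up] at h3
    rw [S.mem_lowestCells] at h1
    exact Prod.ext (by simp only at h3 ⊢; omega) h1.2.2.2
  · rintro rfl
    refine ⟨hlow, ?_⟩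
    intro b hb
    rw [hlab _ hb, hlab _ hlow, up_le_up]
    exact (S.mem_lowestCells.1 hb).2.1

lemma mem_ribbon (hq : IsTopRow R e q) {c : ℤ} {i : ℕ} : (c, h - (i : ℤ)) ∈ ribbon P ↔
    q ≤ i ∧ i < R ∧ l (R - 1) ≤ c ∧ c ≤ e i ∧ (i + 1 < R → e (i + 1) ≤ c) := by
  classical
  have hR : 0 < R := by have := hq.lt; omega
  unfold ribbon
  simp only [Finset.mem_filter]
  rw [S.mem_row]
  simp only [S.isRibbonStart_iff hq, S.isRibbonEnd_iff hR]
  have h1 : ((c + 1, h - (i : ℤ) - 1) ∈ P) ↔ (i + 1 < R ∧ l (i + 1) ≤ c + 1 ∧ c + 1 ≤ e (i + 1)) := by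
    rw [← S.mem_row]
    push_cast
    rw [show h - ((i : ℤ) + 1) = h - i - 1 by ring]
  rw [h1]
  constructor
  · rintro ⟨⟨h2, h3, h4⟩, h5, _, _, rfl, rfl, h6, h7⟩
    simp only at h6 h7
    refine ⟨by omega, h2, h7, h4, fun h8 => ?_⟩
    have := S.mono (i + 1) (R - 1) (by omega) (by omega)
    by_contra hc
    exact h5 ⟨h8, by omega, by omega⟩
  · rintro ⟨h2, h3, h4, h5, h6⟩
    have := S.mono i (R - 1) (by omega) (by omega)
    refine ⟨⟨h3, by omega, h5⟩, ?_, _, _, rfl, rfl, ?_, h4⟩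
    · rintro ⟨h7, h8, h9⟩
      have := h6 h7
      omega
    · simp only
      omega

omit S in
lemma _root_.PolyNet.ribbon_subset : ribbon P ⊆ P := by
  classical
  unfold ribbon
  exact Finset.filter_subset _ _

/-- Below row `q` the ends move weakly left, so the part of the ribbon in a lower row lies weakly
left of the part in a higher one. The last square is the end of row `q`, where `column - height` is
maximal by the choice of `q`. -/
lemma isPath_ribbon (hq : IsTopRow R e q) : IsPath (ribbon P) := by
  have hcell : ∀ a ∈ ribbon P, ∃ i : ℕ, a = (a.1, h - (i : ℤ)) ∧
      q ≤ i ∧ i < R ∧ l (R - 1) ≤ a.1 ∧ a.1 ≤ e i ∧ (i + 1 < R → e (i + 1) ≤ a.1) := by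
    intro a ha
    obtain ⟨i, _, h1, _⟩ := S.mem_cell (ribbon_subset ha)
    rw [h1] at ha
    exact ⟨i, h1, (S.mem_ribbon hq).1 ha⟩
  -- a lower row lies weakly to the left
  have hleft : ∀ {i j : ℕ} {x y : ℤ}, q ≤ i → i < j → j < R → (i + 1 < R → e (i + 1) ≤ x) →
      y ≤ e j → y ≤ x := by
    intro i j x y h1 h2 h3 h4 h5
    have := S.e_anti hq (i := i + 1) (j := j) (by omega) (by omega) h3
    have := h4 (by omega)
    omega
  refine ⟨?_, ?_, ?_⟩
  · intro a ha b hb hab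
    obtain ⟨i, h1, h2, h3, h4, h5, h6⟩ := hcell a ha
    obtain ⟨j, k1, k2, k3, k4, k5, k6⟩ := hcell b hb
    have ha2 : a.2 = h - i := by rw [h1]
    have hb2 : b.2 = h - j := by rw [k1]
    have hij : i = j := by
      rcases lt_trichotomy i j with hlt | heq | hgt
      · have := hleft h2 hlt k3 h6 k5
        omega
      · exact heq
      · have := hleft k2 hgt h3 k6 h5
        omega
    subst hij
    rw [h1, k1]
    congr 1
    omega
  · intro a ha b hb hab
    obtain ⟨i, h1, h2, h3, h4, h5, h6⟩ := hcell a ha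
    obtain ⟨j, k1, k2, k3, k4, k5, k6⟩ := hcell b hb
    have ha2 : a.2 = h - i := by rw [h1]
    have hb2 : b.2 = h - j := by rw [k1]
    rw [ha2]
    by_cases h7 : a.1 < e i
    · left
      rw [S.mem_ribbon hq]
      exact ⟨h2, h3, by omega, by omega, fun h => by have := h6 h; omega⟩
    · right
      have hqi : q < i := by
        by_contra hc
        obtain rfl : i = q := by omega
        rcases k2.eq_or_lt with heq | hlt
        · subst heq
          omega
        · have := hleft h2 hlt k3 h6 k5
          omega
      have h8 := S.e_anti hq (i := i - 1) (j := i) (by omega) (by omega) h3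
      have h9 : h - (i : ℤ) + 1 = h - ((i - 1 : ℕ) : ℤ) := by omega
      rw [h9, S.mem_ribbon hq]
      refine ⟨by omega, by omega, h4, by omega, ?_⟩
      rw [show i - 1 + 1 = i by omega]
      omega
  · rintro -
    refine ⟨(e q, h - (q : ℤ)), (S.mem_ribbon hq).2 ⟨le_rfl, hq.lt, ?_, le_rfl, ?_⟩, ?_⟩
    · have := S.e_anti hq (i := q) (j := R - 1) le_rfl (by have := hq.lt; omega)
        (by have := hq.lt; omega)
      have := S.le (R - 1) (by have := hq.lt; omega)
      omega
    · exact fun h1 => S.e_anti hq le_rfl (by omega) h1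
    · intro a ha
      obtain ⟨i, h1, h2, h3, h4, h5, h6⟩ := hcell a ha
      have ha2 : a.2 = h - i := by rw [h1]
      have := hq.le i h3
      have := S.e_anti hq le_rfl h2 h3
      simp only
      omega

/-- Within a row `column - height` is largest at the row end, so the condition of
`exists_maximal_iff` need only be tested at the ends of the lower rows. This is the hypothesis of
`southIndex_eq`. -/
lemma isTileStart_iff (hq : IsTopRow R e q) {c : ℤ} {i : ℕ} :
    IsTileStart P (c, h - (i : ℤ)) ↔
      (q ≤ i ∧ i < R ∧ l (R - 1) ≤ c ∧ c ≤ e i ∧ (i + 1 < R → e (i + 1) ≤ c)) ∧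
        ∀ j, i < j → j < R → e j + j < c + i := by
  unfold IsTileStart
  rw [(S.isPath_ribbon hq).exists_maximal_iff, S.mem_ribbon hq]
  refine and_congr_right ?_
  rintro ⟨h1, h2, h3, h4, h5⟩
  simp only
  constructor
  · intro hrec j hij hj
    have h6 := S.e_anti hq (i := i + 1) (j := j) (by omega) (by omega) hj
    have h7 := h5 (by omega)
    have h8 := S.e_anti hq (i := j) (j := R - 1) (by omega) (by omega) (by omega)
    have h9 := S.le (R - 1) (by omega)
    have := hrec (e j, h - (j : ℤ)) ((S.mem_ribbon hq).2 ⟨by omega, hj, by omega, le_rfl,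
      fun h => S.e_anti hq (by omega) (by omega) h⟩) (by simp only; omega)
    simp only at this
    omega
  · intro hrec b hb hlt
    obtain ⟨j, hj, hbj, _⟩ := S.mem_cell (ribbon_subset hb)
    have hb2 : b.2 = h - j := by rw [hbj]
    rw [hbj, S.mem_ribbon hq] at hb
    obtain ⟨k2, k3, k4, k5, k6⟩ := hb
    rcases lt_trichotomy i j with hij | hij | hij
    · have := hrec j hij hj
      omega
    · subst hij
      omega
    · have := S.e_anti hq (i := j + 1) (j := i) (by omega) (by omega) h2
      have := k6 (by omega)
      omega

/-- The lower bound is the record condition against the end of the lowest row, the upper one the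
maximality of `e q + q`. The last clause locates the tile with the minimal label. -/
lemma southLabel_tileStart (hq : IsTopRow R e q) {c : ℤ} {i : ℕ}
    (ht : IsTileStart P (c, h - (i : ℤ))) :
    southLabel P (c, h - (i : ℤ)) = up e R (c - ((R : ℤ) - 1 - i)) ∧
      l (R - 1) ≤ c - ((R : ℤ) - 1 - i) ∧ c - ((R : ℤ) - 1 - i) ≤ e q - ((R : ℤ) - 1 - q) ∧
      (c - ((R : ℤ) - 1 - i) = l (R - 1) → c = l (R - 1)) := by
  obtain ⟨⟨h1, h2, h3, h4, h5⟩, h6⟩ := (S.isTileStart_iff hq).1 ht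
  have h7 := S.southIndex_eq hq h1 h2 h4 h6
  have h8 := hq.le i h2
  have hp := S.pos (R - 1) (by omega)
  have h9 : l (R - 1) ≤ c - ((R : ℤ) - 1 - i) ∧
      (c - ((R : ℤ) - 1 - i) = l (R - 1) → c = l (R - 1)) := by
    rcases (show i ≤ R - 1 by omega).eq_or_lt with h10 | h10
    · omega
    · have h11 := h6 (R - 1) h10 (by omega)
      have h12 := S.le (R - 1) (by omega)
      omega
  refine ⟨?_, h9.1, by omega, h9.2⟩
  rw [S.southLabel_eq (by omega), h7]

lemma exists_tileStart (hq : IsTopRow R e q) {x : ℤ} (h1 : l (R - 1) ≤ x)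
    (h2 : x ≤ e q - ((R : ℤ) - 1 - q)) :
    ∃ (c : ℤ) (i : ℕ), IsTileStart P (c, h - (i : ℤ)) ∧ c - ((R : ℤ) - 1 - i) = x := by
  -- The tile start must satisfy `c + i = x + R - 1`; it lies in the lowest row whose end reaches
  -- this diagonal, since then all later ends stay short of it.
  obtain ⟨i, hi, hmax⟩ := Finset.exists_max_image
    ((Finset.Ico q R).filter fun i : ℕ => x + R - 1 ≤ e i + i) id
    ⟨q, Finset.mem_filter.2 ⟨Finset.mem_Ico.2 ⟨le_rfl, hq.lt⟩, by omega⟩⟩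
  rw [Finset.mem_filter, Finset.mem_Ico] at hi
  have hrec : ∀ j, i < j → j < R → e j + j < x + R - 1 := by
    intro j hij hj
    by_contra hc
    have := hmax j (Finset.mem_filter.2 ⟨Finset.mem_Ico.2 ⟨by omega, hj⟩, by omega⟩)
    simp only [id] at this
    omega
  refine ⟨x + R - 1 - i, i, (S.isTileStart_iff hq).2 ⟨⟨hi.1.1, hi.1.2, ?_, by omega, ?_⟩, ?_⟩,
    by omega⟩
  · omega
  · intro h3
    have := hrec (i + 1) (by omega) h3
    push_cast at this
    omega
  · intro j hij hj
    have := hrec j hij hj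
    omega

/-! ### The squares to the lower left -/

lemma southLabelHeight_of_lt {c : ℤ} {a : ℕ} (hc : c < l (R - 1)) :
    southLabelHeight P (c, h - (a : ℤ)) = h - (a : ℤ) - 1 := by
  unfold southLabelHeight
  rw [if_neg]
  rintro ⟨b, hb, h1⟩
  have := (S.mem_lowestCells.1 hb).2.1
  simp only at h1
  omega

/-- The minimal tile label belongs to a square in the first column of the lowest row. Left of this
column no south edge is covered and each label is written directly below its square, so the
condition on its height selects the rows from `q` on. -/
lemma isLowerLeft_iff (hq : IsTopRow R e q) {c : ℤ} {i : ℕ} :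
    IsLowerLeft P (c, h - (i : ℤ)) ↔ q ≤ i ∧ i + 1 < R ∧ l i ≤ c ∧ c < l (i + 1) := by
  classical
  have hR : 0 < R := by have := hq.lt; omega
  have hle := S.le (R - 1) (by omega)
  have hright : (∃ t, IsTileStart P t ∧
      (∀ u, IsTileStart P u → southLabel P t ≤ southLabel P u) ∧ c < t.1) ↔
      c < l (R - 1) := by
    obtain ⟨c₀, i₀, ht₀, hx₀⟩ := S.exists_tileStart hq (x := l (R - 1)) le_rfl (by
      have := hq.le (R - 1) (by omega)
      have := hq.lt
      omega)
    have hs₀ := S.southLabel_tileStart hq ht₀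
    have hc₀ := hs₀.2.2.2 hx₀
    rw [hx₀] at hs₀
    have hform : ∀ u, IsTileStart P u → ∃ i : ℕ, u = (u.1, h - (i : ℤ)) := by
      rintro u ⟨d, hd, hm⟩
      obtain ⟨i, _, h1, _⟩ := S.mem_cell (ribbon_subset (hm.1.2 hd.spec.1))
      exact ⟨i, h1⟩
    constructor
    · rintro ⟨t, ht, hmin, hct⟩
      obtain ⟨i, hti⟩ := hform t ht
      have h1 := hmin _ ht₀
      rw [hti] at ht h1
      have h2 := S.southLabel_tileStart hq ht
      rw [h2.1, hs₀.1, up_le_up] at h1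
      have := h2.2.2.2 (by omega)
      omega
    · intro hc
      refine ⟨_, ht₀, ?_, by simp only; omega⟩
      intro u hu
      obtain ⟨i, hui⟩ := hform u hu
      rw [hui] at hu ⊢
      have h2 := S.southLabel_tileStart hq hu
      rw [h2.1, hs₀.1, up_le_up]
      exact h2.2.1
  unfold IsLowerLeft
  rw [hright]
  simp only [S.isRibbonStart_iff hq, exists_eq_left]
  unfold freeEdges
  rw [Finset.mem_sdiff, S.southEdge_iff]
  constructor
  · rintro ⟨⟨⟨⟨h1, h2, h3⟩, h4⟩, _⟩, hc, h5⟩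
    rw [S.southLabelHeight_of_lt hc] at h5
    have hqi : q ≤ i := by omega
    have hiR : i + 1 < R := by
      by_contra hcon
      obtain rfl : i = R - 1 := by omega
      omega
    have := S.e_anti hq (i := i + 1) (j := R - 1) (by omega) (by omega) (by omega)
    exact ⟨hqi, hiR, h2, by
      by_contra hcon
      exact h4 ⟨hiR, by omega, by omega⟩⟩
  · rintro ⟨h1, h2, h3, h4⟩
    have h5 := S.mono (i + 1) (R - 1) (by omega) (by omega)
    have h6 := S.e_anti hq (i := i) (j := R - 1) (by omega) (by omega) (by omega)
    refine ⟨⟨⟨⟨by omega, h3, by omega⟩, by omega⟩, ?_⟩, by omega, ?_⟩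
    · intro hcov
      obtain ⟨_, j, hj, hcov⟩ := S.mem_coveredEdges.1 hcov
      have := S.le_of_covers (S.mem_row.2 ⟨by omega, h3, by omega⟩) hcov (k := R - 1)
        (by omega) (by omega)
      omega
    · rw [S.southLabelHeight_of_lt (by omega)]
      omega

/-! ### The edges of one step -/

/-- The interval splits at `l (R - 1)`. The smaller `x` are the columns of the squares to the lower
left, whose index is the column itself; the others are the indices of the tile starts. -/
theorem stepEdges_eq (hq : IsTopRow R e q) : stepEdges P =
    {g | ∃ x, l q ≤ x ∧ x ≤ e q - ((R : ℤ) - 1 - q) ∧ g = (up e R x, rowLabel e q)} := by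
  have hR : 0 < R := by have := hq.lt; omega
  ext g
  unfold stepEdges
  simp only [S.isRibbonStart_iff hq, Set.mem_ofPred_eq]
  constructor
  · rintro ⟨_, s, rfl, hs, rfl⟩
    rw [S.eastLabel_eq hq.lt]
    have hsP : s ∈ P := by
      rcases hs with ⟨d, hd, hm⟩ | hs
      · exact ribbon_subset (hm.1.2 hd.spec.1)
      · exact freeEdges_subset hs.1
    obtain ⟨i, hi, hsi, _⟩ := S.mem_cell hsP
    rw [hsi] at hs ⊢
    rcases hs with hs | hs
    · have h1 := S.southLabel_tileStart hq hs
      have h2 := S.mono q (R - 1) (by have := hq.lt; omega) (by omega)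
      exact ⟨_, by omega, h1.2.2.1, by rw [h1.1]⟩
    · obtain ⟨h1, h2, h3, h4⟩ := (S.isLowerLeft_iff hq).1 hs
      have h5 := S.mono (i + 1) (R - 1) (by omega) (by omega)
      have h6 := S.mono q i h1 hi
      have h7 := S.le (R - 1) (by omega)
      have h8 := hq.le (R - 1) (by omega)
      have h9 := S.pos i hi
      have h10 := S.southIndex_of_le hR (c := (s.1, h - (i : ℤ))) (by simp only; omega)
      refine ⟨s.1, by omega, by have := hq.lt; omega, ?_⟩
      rw [S.southLabel_eq (by rw [h10]; simp only; omega), h10]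
  · rintro ⟨x, h1, h2, rfl⟩
    rw [← S.eastLabel_eq hq.lt]
    rcases lt_or_ge x (l (R - 1)) with h3 | h3
    · obtain ⟨i, hi, hmax⟩ := Finset.exists_max_image
        ((Finset.Ico q R).filter fun i : ℕ => l i ≤ x) id
        ⟨q, Finset.mem_filter.2 ⟨Finset.mem_Ico.2 ⟨le_rfl, hq.lt⟩, h1⟩⟩
      rw [Finset.mem_filter, Finset.mem_Ico] at hi
      have hiR : i + 1 < R := by
        by_contra hcon
        obtain rfl : i = R - 1 := by omega
        omega
      have h4 : x < l (i + 1) := by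
        by_contra hc
        have := hmax (i + 1) (Finset.mem_filter.2 ⟨Finset.mem_Ico.2 ⟨by omega, hiR⟩, by omega⟩)
        simp only [id] at this
        omega
      have h7 := S.le (R - 1) (by omega)
      have h9 := S.pos i hi.1.2
      have h10 := S.southIndex_of_le hR (c := (x, h - (i : ℤ))) (by simp only; omega)
      refine ⟨_, (x, h - (i : ℤ)), rfl,
        Or.inr ((S.isLowerLeft_iff hq).2 ⟨hi.1.1, hiR, hi.2, h4⟩), ?_⟩
      rw [S.southLabel_eq (by rw [h10]; simp only; omega), h10]
    · obtain ⟨c, i, ht, hx⟩ := S.exists_tileStart hq h3 h2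
      refine ⟨_, _, rfl, Or.inl ht, ?_⟩
      rw [(S.southLabel_tileStart hq ht).1, hx]

end RowShape

/-! ### The next polyomino -/

/-- The numbering of the rows other than `q`. -/
def skip (q i : ℕ) : ℕ := if i < q then i else i + 1

/-- The first columns of the rows after one step. -/
def nextStart (l : ℕ → ℤ) (q i : ℕ) : ℤ := if i < q then l i else l (i + 1) + 1

lemma skip_of_lt {q i : ℕ} (h : i < q) : skip q i = i := if_pos h
lemma skip_of_ge {q i : ℕ} (h : q ≤ i) : skip q i = i + 1 := if_neg (by omega)
lemma nextStart_of_lt {l : ℕ → ℤ} {q i : ℕ} (h : i < q) : nextStart l q i = l i := if_pos h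
lemma nextStart_of_ge {l : ℕ → ℤ} {q i : ℕ} (h : q ≤ i) : nextStart l q i = l (i + 1) + 1 :=
  if_neg (by omega)

lemma skip_lt_skip {q i j : ℕ} (h : i < j) : skip q i < skip q j := by
  unfold skip
  split_ifs <;> omega

/-- A label from below that ends left of the maximal one arrives at row `q` weakly left of the end
of that row. Row `q` does not move it, so omitting the row changes nothing. -/
lemma IsTopRow.rowLabel_skip {R q : ℕ} {e : ℕ → ℤ} (hq : IsTopRow R e q) {i : ℕ}
    (hi : skip q i < R) : rowLabel (e ∘ skip q) i = rowLabel e (skip q i) := by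
  rcases lt_or_ge i q with h | h
  · rw [skip_of_lt h]
    apply rowLabel_congr
    intro j hj
    simp [skip_of_lt (show j < q by omega)]
  · have key : ∀ n, q ≤ n → ∀ x, up e (n + 1) x < rowLabel e q →
        up (e ∘ skip q) n x = up e (n + 1) x := by
      intro n hn
      induction n, hn using Nat.le_induction with
      | base =>
        intro x hx
        rw [up, rowLabel, up_lt_up] at hx
        rw [up, pass_of_le]
        · apply up_congr
          intro j hj
          simp [skip_of_lt hj]
        · by_contra hc
          rw [pass_of_lt (by omega)] at hx
          omega
      | succ n hn ih =>
        intro x hx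
        rw [up] at hx
        rw [up, ih _ (by simpa [skip_of_ge hn] using hx), up]
        simp [skip_of_ge hn, up]
    rw [skip_of_ge h] at hi ⊢
    have h1 := key i h (e (i + 1) + 1) (by
      have h2 := hq.rowLabel_le hi
      rcases h2.eq_or_lt with h3 | h3
      · have := rowLabel_injective e h3
        omega
      · exact h3)
    rw [rowLabel, rowLabel, ← h1]
    simp [skip_of_ge h]

namespace RowShape

variable {P : Finset Cell} {h : ℤ} {R q : ℕ} {l e : ℕ → ℤ} (S : RowShape P h R l e)
include S

/-- In a row `i ≥ q` above the lowest one, the squares to the lower left are those before `l (i +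
1)` and the ribbon removes those from `e (i + 1)` on. What remains, moved right by one, is row `i +
1` without its first square. The lowest row lies in the ribbon. -/
lemma mem_reduce (hq : IsTopRow R e q) {c r : ℤ} : (c, r) ∈ reduce P ↔
    ∃ i : ℕ, r = h - (i : ℤ) ∧ skip q i < R ∧ nextStart l q i ≤ c ∧ c ≤ e (skip q i) := by
  classical
  have hcut : ∀ b : Cell, (∃ cr, IsRibbonStart P cr ∧ b.2 ≤ cr.2) ↔ b.2 ≤ h - q := by
    intro b
    simp only [S.isRibbonStart_iff hq, exists_eq_left]
  have hkeep : ∀ (x : ℤ) (i : ℕ), q ≤ i →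
      ((x, h - (i : ℤ)) ∈ P ∧ (x, h - (i : ℤ)) ∉ ribbon P ∧ ¬ IsLowerLeft P (x, h - (i : ℤ)) ↔
        i + 1 < R ∧ l (i + 1) ≤ x ∧ x + 1 ≤ e (i + 1)) := by
    intro x i hi
    rw [S.mem_row, S.mem_ribbon hq, S.isLowerLeft_iff hq]
    constructor
    · rintro ⟨⟨h1, h2, h3⟩, h4, h5⟩
      by_cases h6 : i + 1 < R
      · have h7 := S.e_anti hq (i := i + 1) (j := R - 1) (by omega) (by omega) (by omega)
        have h8 := S.le (R - 1) (by omega)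
        refine ⟨h6, ?_, ?_⟩
        · by_contra hc
          exact h5 ⟨hi, h6, h2, by omega⟩
        · by_contra hc
          exact h4 ⟨hi, h1, by omega, h3, fun _ => by omega⟩
      · exfalso
        obtain rfl : i = R - 1 := by omega
        exact h4 ⟨hi, h1, h2, h3, fun h => absurd h h6⟩
    · rintro ⟨h1, h2, h3⟩
      have h4 := S.e_anti hq hi (Nat.le_succ i) h1
      have h5 := S.mono i (i + 1) (by omega) h1
      rw [Nat.succ_eq_add_one] at h4
      refine ⟨⟨by omega, by omega, by omega⟩, ?_, ?_⟩
      · rintro ⟨_, _, _, _, h6⟩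
        have := h6 h1
        omega
      · omega
  unfold reduce
  simp only [Finset.mem_image, Finset.mem_filter, hcut]
  constructor
  · rintro ⟨b, ⟨hb, h1, h2⟩, h3⟩
    obtain ⟨i, hi, hbi, h4, h5⟩ := S.mem_cell hb
    have hb2 : b.2 = h - i := by rw [hbi]
    refine ⟨i, ?_⟩
    rcases lt_or_ge i q with hiq | hiq
    · rw [if_neg (by omega)] at h3
      subst h3
      rw [skip_of_lt hiq, nextStart_of_lt hiq]
      exact ⟨hb2, hi, h4, h5⟩
    · rw [if_pos (by omega)] at h3
      obtain ⟨rfl, rfl⟩ := Prod.mk.inj h3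
      rw [hbi] at hb h1 h2
      have := (hkeep _ _ hiq).1 ⟨hb, h1, h2⟩
      rw [skip_of_ge hiq, nextStart_of_ge hiq]
      exact ⟨hb2, by omega, by omega, by omega⟩
  · rintro ⟨i, rfl, h1, h2, h3⟩
    rcases lt_or_ge i q with hiq | hiq
    · rw [skip_of_lt hiq] at h1 h3
      rw [nextStart_of_lt hiq] at h2
      refine ⟨(c, h - (i : ℤ)), ⟨S.mem_row.2 ⟨h1, h2, h3⟩, ?_, ?_⟩, ?_⟩
      · rw [S.mem_ribbon hq]
        omega
      · rw [S.isLowerLeft_iff hq]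
        omega
      · rw [if_neg (by simp only; omega)]
    · rw [skip_of_ge hiq] at h1 h3
      rw [nextStart_of_ge hiq] at h2
      refine ⟨(c - 1, h - (i : ℤ)), (hkeep _ _ hiq).2 ⟨h1, by omega, by omega⟩, ?_⟩
      rw [if_pos (by simp only; omega)]
      simp

/-- Rows can become empty only from `q` on, where the starts increase and the ends decrease; hence
the non-empty rows form an initial segment. -/
theorem exists_reduce (hq : IsTopRow R e q) :
    ∃ R' : ℕ, RowShape (reduce P) h R' (nextStart l q) (e ∘ skip q) ∧
      ∀ i, i < R' ↔ skip q i < R ∧ nextStart l q i ≤ e (skip q i) := by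
  classical
  have hex : ∃ i, ¬ (skip q i < R ∧ nextStart l q i ≤ e (skip q i)) :=
    ⟨R, fun h1 => by
      have := h1.1
      unfold skip at this
      split_ifs at this <;> omega⟩
  have hiff : ∀ i, i < Nat.find hex ↔ skip q i < R ∧ nextStart l q i ≤ e (skip q i) := by
    intro i
    constructor
    · intro hi
      exact not_not.1 (Nat.find_min hex hi)
    · intro hi
      by_contra hc
      have hspec := Nat.find_spec hex
      set n := Nat.find hex
      have hlt : n < i := by
        rcases (not_lt.1 hc).eq_or_lt with h1 | h1
        · rw [h1] at hspec
          exact absurd hi hspec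
        · exact h1
      apply hspec
      have h1 := skip_lt_skip (q := q) hlt
      refine ⟨h1.trans hi.1, ?_⟩
      rcases lt_or_ge n q with h2 | h2
      · rw [skip_of_lt h2, nextStart_of_lt h2]
        exact S.le n (by have := hq.lt; omega)
      · have h3 := hi.1
        have h4 := hi.2
        rw [skip_of_ge (by omega)] at h3 h4
        rw [nextStart_of_ge (by omega)] at h4
        rw [skip_of_ge h2, nextStart_of_ge h2]
        have := S.mono (n + 1) (i + 1) (by omega) h3
        have := S.e_anti hq (i := n + 1) (j := i + 1) (by omega) (by omega) h3
        omega
  refine ⟨Nat.find hex, ⟨?_, fun i hi => ((hiff i).1 hi).2, ?_, ?_, ?_⟩, hiff⟩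
  · intro c r
    rw [S.mem_reduce hq]
    simp only [hiff, Function.comp_apply]
    constructor
    · rintro ⟨i, h1, h2, h3, h4⟩
      exact ⟨i, ⟨h2, h3.trans h4⟩, h1, h3, h4⟩
    · rintro ⟨i, ⟨h1, _⟩, h2, h3, h4⟩
      exact ⟨i, h2, h1, h3, h4⟩
  · intro i j hij hj
    have hj := ((hiff j).1 hj).1
    unfold nextStart
    unfold skip at hj
    split_ifs at hj ⊢
    · exact S.mono i j hij hj
    · have := S.mono i (j + 1) (by omega) hj
      omega
    · omega
    · have := S.mono (i + 1) (j + 1) (by omega) hj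
      omega
  · intro i hi
    have hi := ((hiff i).1 hi).1
    unfold nextStart
    unfold skip at hi
    split_ifs at hi ⊢
    · exact S.pos i hi
    · have := S.pos (i + 1) hi
      omega
  · intro i j k hij hjk hk
    exact S.valley _ _ _ (skip_lt_skip hij) (skip_lt_skip hjk) ((hiff k).1 hk).1

end RowShape

/-! ### Rows and permutations -/

/-- The rows of a polyomino describe the inverse `π` of the permutation given by its labels: the
label of row `i` has position `l i + i`, and the squares of row `i` correspond to the smaller labels
to its right. -/
structure Link (m : ℕ) (π : Equiv.Perm ℤ) (R : ℕ) (l e : ℕ → ℤ) : Prop where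
  perm : IsPermutation m π
  le : ∀ i < R, rowLabel e i ≤ m
  position : ∀ i < R, π (rowLabel e i) = l i + i
  code : ∀ i < R, (code π (rowLabel e i) : ℤ) = e i - l i + 1
  zero : ∀ v : ℤ, 1 ≤ v → v ≤ m → (∀ i < R, v ≠ rowLabel e i) → PolyNet.code π v = 0

namespace RowShape

variable {P : Finset Cell} {h : ℤ} {R q m : ℕ} {l e : ℕ → ℤ} {π : Equiv.Perm ℤ}
  (S : RowShape P h R l e)
include S

lemma one_lt_rowLabel {i : ℕ} (hi : i < R) : 1 < rowLabel e i := by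
  have := le_up e i (e i + 1)
  have := S.one_le_e hi
  unfold rowLabel
  omega

lemma one_le_up {x : ℤ} : 1 ≤ up e R x ↔ 1 ≤ x := up_pos_iff fun _ hj => S.one_le_e hj

/-- Both row labels and the labels `up e R y` occur in increasing order of their index, and the
label of row `q` has position `l q + q`. Both directions compare this number with a count of labels.
-/
lemma position_lt_iff (hL : Link m π R l e) (hq : q < R) {x : ℤ} (hx : 1 ≤ x)
    (hxm : up e R x ≤ m) : π (rowLabel e q) < π (up e R x) ↔ l q ≤ x := by
  have hmono : ∀ y z : ℤ, 1 ≤ y → y < z → up e R z ≤ m → π (up e R y) < π (up e R z) := by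
    intro y z hy hyz hz
    refine code_eq_zero.1 (hL.zero _ (S.one_le_up.2 (by omega)) hz ?_) _ (S.one_le_up.2 hy)
      (up_lt_up.2 hyz)
    exact fun i hi => up_ne_rowLabel hi z
  have hpos := hL.position q hq
  classical
  constructor
  · intro hlt
    set B := (Finset.Icc 1 (x - 1)).image (up e R) ∪ (Finset.range (q + 1)).image (rowLabel e)
      with hB
    -- Up to its position only rows `0, …, q` and indices below `x` can occur, so `l q + q ≤ (x - 1)
    -- + (q + 1)`.
    have hsub : (Finset.Icc 1 (l q + q)).image (π⁻¹ : Equiv.Perm ℤ) ⊆ B := by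
      intro u hu
      obtain ⟨p, hp, rfl⟩ := Finset.mem_image.1 hu
      rw [Finset.mem_Icc] at hp
      have hle := hL.perm.mapsTo (v := rowLabel e q) (S.one_lt_rowLabel hq).le (hL.le q hq)
      have hu := hL.perm.inv.mapsTo (v := p) hp.1 (by omega)
      have hpi : π (π⁻¹ p) = p := by simp
      set u := π⁻¹ p
      rw [Finset.mem_union, Finset.mem_image, Finset.mem_image]
      by_cases hE : ∃ i < R, u = rowLabel e i
      · right
        obtain ⟨i, hi, hui⟩ := hE
        refine ⟨i, ?_, hui.symm⟩
        rw [Finset.mem_range]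
        by_contra hc
        have h1 := hL.position i hi
        have h2 := S.mono q i (by omega) hi
        rw [← hui] at h1
        omega
      · left
        push Not at hE
        obtain ⟨y, hy⟩ := exists_up_iff.2 hE
        refine ⟨y, ?_, hy⟩
        have h1 : 1 ≤ y := S.one_le_up.1 (by omega)
        rw [Finset.mem_Icc]
        refine ⟨h1, ?_⟩
        by_contra hc
        rcases (show x ≤ y by omega).eq_or_lt with h2 | h2
        · rw [h2, hy] at hlt
          omega
        · have := hmono x y hx h2 (by omega)
          rw [hy] at this
          omega
    have h1 := Finset.card_le_card hsub
    rw [Finset.card_image_of_injective _ (π⁻¹).injective, Int.card_Icc] at h1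
    have h2 := Finset.card_union_le ((Finset.Icc 1 (x - 1)).image (up e R))
      ((Finset.range (q + 1)).image (rowLabel e))
    rw [← hB, Finset.card_image_of_injective _ (up_strictMono e R).injective,
      Finset.card_image_of_injective _ (rowLabel_injective e), Int.card_Icc,
      Finset.card_range] at h2
    have := S.pos q hq
    omega
  · intro hlx
    by_contra hc
    have hne : π (rowLabel e q) ≠ π (up e R x) := fun h1 =>
      up_ne_rowLabel hq x (π.injective h1).symm
    -- All these `x + q` labels would precede position `l q + q`, contradicting `l q ≤ x`.
    set A := (Finset.Icc 1 x).image (up e R) ∪ (Finset.range q).image (rowLabel e) with hA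
    have hcard : A.card = x.toNat + q := by
      rw [hA, Finset.card_union_of_disjoint, Finset.card_image_of_injective _
        (up_strictMono e R).injective, Finset.card_image_of_injective _ (rowLabel_injective e),
        Int.card_Icc, Finset.card_range]
      · omega
      · rw [Finset.disjoint_left]
        intro u hu hu'
        obtain ⟨y, _, rfl⟩ := Finset.mem_image.1 hu
        obtain ⟨i, hi, h1⟩ := Finset.mem_image.1 hu'
        rw [Finset.mem_range] at hi
        exact up_ne_rowLabel (by omega) y h1.symm
    have hsub : A.image π ⊆ Finset.Icc 1 (l q + q - 1) := by
      intro p hp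
      obtain ⟨u, hu, rfl⟩ := Finset.mem_image.1 hp
      rw [Finset.mem_Icc]
      rcases Finset.mem_union.1 hu with hu | hu
      · obtain ⟨y, hy, rfl⟩ := Finset.mem_image.1 hu
        rw [Finset.mem_Icc] at hy
        have h1 : π (up e R y) ≤ π (up e R x) := by
          rcases hy.2.eq_or_lt with h2 | h2
          · rw [h2]
          · exact (hmono y x hy.1 h2 hxm).le
        have h2 := hL.perm.mapsTo (v := up e R y) (S.one_le_up.2 hy.1)
          ((up_le_up.2 hy.2).trans hxm)
        omega
      · obtain ⟨i, hi, rfl⟩ := Finset.mem_image.1 hu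
        rw [Finset.mem_range] at hi
        have h1 := hL.position i (by omega)
        have h2 := S.mono i q (by omega) hq
        have h3 := S.pos i (by omega)
        omega
    have h1 := Finset.card_le_card hsub
    rw [Finset.card_image_of_injective _ π.injective, hcard, Int.card_Icc] at h1
    have := S.pos q hq
    omega

/-- Row labels have positive code, so the records are the values of `up e R`; the two remaining
conditions bound the index from below and above. -/
lemma roundEdges_eq (hq : IsTopRow R e q) (hL : Link (m + 1) π R l e)
    (hm : rowLabel e q = (m : ℤ) + 1) : roundEdges ((m : ℤ) + 1) π = stepEdges P := by
  have hlt : ∀ x, up e R x < rowLabel e q ↔ x ≤ e q - ((R : ℤ) - 1 - q) := by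
    intro x
    have hqR := hq.lt
    have := hq.up_lt_iff (n := R - 1) (by omega) (by omega) (x := x)
    rw [show R - 1 + 1 = R by omega] at this
    rw [this]
    omega
  rw [S.stepEdges_eq hq]
  ext ⟨v, M⟩
  simp only [roundEdges, Set.mem_ofPred_eq, Prod.mk.injEq]
  constructor
  · rintro ⟨rfl, h1, h2, h3, h4⟩
    obtain ⟨x, rfl⟩ := (exists_up_iff (e := e) (i := R)).2 fun i hi hv => by
      have h5 := hL.code i hi
      rw [← hv, h4] at h5
      have := S.le i hi
      omega
    refine ⟨x, ?_, ?_, rfl, hm.symm⟩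
    · rw [← S.position_lt_iff hL hq.lt (S.one_le_up.1 h1) (by push_cast; omega), hm]
      exact h3
    · rw [← hlt, hm]
      exact h2
  · rintro ⟨x, h1, h2, rfl, rfl⟩
    rw [← hlt] at h2
    have h3 := S.pos q hq.lt
    have h4 := S.one_le_up (x := x).2 (by omega)
    refine ⟨hm, h4, by omega, ?_, ?_⟩
    · rw [← hm, S.position_lt_iff hL hq.lt (by omega) (by push_cast; omega)]
      exact h1
    · exact hL.zero _ h4 (by push_cast; omega) fun i hi => up_ne_rowLabel hi x

/-- Labels of rows above `q` are left of the maximal label and do not change. Those of rows below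
are right of it and lose one from their code, as their rows lose a square. A row of a single square
disappears, and its label becomes a record. -/
lemma link_reduce (hq : IsTopRow R e q) (hL : Link (m + 1) π R l e)
    (hm : rowLabel e q = (m : ℤ) + 1) {π' : Equiv.Perm ℤ} (hp : IsPermutation m π')
    (hr : RoundRel ((m : ℤ) + 1) π π') {R' : ℕ}
    (hR' : ∀ i, i < R' ↔ skip q i < R ∧ nextStart l q i ≤ e (skip q i)) :
    Link m π' R' (nextStart l q) (e ∘ skip q) := by
  have hqR := hq.lt
  have hlt : ∀ i < R, i ≠ q → rowLabel e i < (m : ℤ) + 1 := by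
    intro i hi hiq
    rw [← hm]
    rcases (hq.rowLabel_le hi).eq_or_lt with h1 | h1
    · exact absurd (rowLabel_injective e h1) hiq
    · exact h1
  have hposq := hL.position q hqR
  have hsk : ∀ i, skip q i ≠ q := by
    intro i
    unfold skip
    split_ifs <;> omega
  have hmain : ∀ i < R', π' (rowLabel e (skip q i)) = nextStart l q i + i ∧
      (PolyNet.code π' (rowLabel e (skip q i)) : ℤ) = e (skip q i) - nextStart l q i + 1 := by
    intro i hi
    have h1 := (hR' i).1 hi
    have h2 := hL.position _ h1.1
    have h3 := hL.code _ h1.1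
    have h4 := hlt _ h1.1 (hsk i)
    have h5 := S.one_lt_rowLabel h1.1
    rcases lt_or_ge i q with h6 | h6
    · rw [skip_of_lt h6] at *
      rw [nextStart_of_lt h6] at *
      have h7 := S.mono i q h6.le hqR
      have h8 := hr.left _ h5.le h4 (by rw [← hm]; omega)
      rw [h8.1, h8.2]
      exact ⟨h2, h3⟩
    · rw [skip_of_ge h6] at *
      rw [nextStart_of_ge h6] at *
      have h7 := S.mono q (i + 1) (by omega) h1.1
      push_cast at h2
      have h8 := hr.right _ h5.le h4 (by rw [← hm]; omega) (by omega)
      rw [h8.1]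
      omega
  refine ⟨hp, ?_, ?_, ?_, ?_⟩
  · intro i hi
    have h1 := (hR' i).1 hi
    rw [hq.rowLabel_skip h1.1]
    have := hlt _ h1.1 (hsk i)
    omega
  · intro i hi
    rw [hq.rowLabel_skip ((hR' i).1 hi).1]
    exact (hmain i hi).1
  · intro i hi
    rw [hq.rowLabel_skip ((hR' i).1 hi).1]
    exact (hmain i hi).2
  · intro v h1 h2 hv
    by_cases hE : ∃ j < R, v = rowLabel e j
    · obtain ⟨j, hj, rfl⟩ := hE
      have hjq : j ≠ q := by
        rintro rfl
        omega
      have hex : ∃ i, skip q i = j := by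
        rcases lt_or_gt_of_ne hjq with h3 | h3
        · exact ⟨j, skip_of_lt h3⟩
        · exact ⟨j - 1, by rw [skip_of_ge (by omega)]; omega⟩
      obtain ⟨i, rfl⟩ := hex
      have h3 : ¬ i < R' := fun h3 => hv i h3 (hq.rowLabel_skip hj).symm
      rw [hR'] at h3
      have h4 := S.le _ hj
      have h5 := hL.position _ hj
      have h6 := hL.code _ hj
      rcases lt_or_ge i q with h7 | h7
      · rw [skip_of_lt h7] at *
        rw [nextStart_of_lt h7] at h3
        exact absurd ⟨hj, h4⟩ h3
      · rw [skip_of_ge h7] at *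
        rw [nextStart_of_ge h7] at h3
        have h8 := S.mono q (i + 1) (by omega) hj
        push_cast at h5
        have h9 := hr.right _ h1 (by omega) (by rw [← hm]; omega) (by omega)
        have h10 : ¬ (l (i + 1) + 1 ≤ e (i + 1)) := fun h => h3 ⟨hj, h⟩
        omega
    · push Not at hE
      exact hr.code_zero h1 (by omega) (hL.zero v h1 (by push_cast; omega) hE)

end RowShape

/-! ### The sequence of polyominoes -/

lemma polyominoEdges_eq (P : Finset Cell) :
    polyominoEdges P = stepEdges P ∪ polyominoEdges (reduce P) := by
  unfold polyominoEdges
  rw [← Set.union_iUnion_nat_succ]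
  rfl

lemma reduce_empty : reduce ∅ = ∅ := by
  classical
  unfold reduce
  rw [Finset.filter_empty, Finset.image_empty]

lemma iterate_reduce_empty (k : ℕ) : reduce^[k] ∅ = ∅ := Function.iterate_fixed reduce_empty k

lemma polyominoEdges_empty : polyominoEdges ∅ = ∅ := by
  unfold polyominoEdges
  simp only [iterate_reduce_empty, Set.iUnion_const]
  ext g
  constructor
  · rintro ⟨cr, s, h, _⟩
    unfold IsRibbonStart eastEdges at h
    rw [Finset.filter_empty] at h
    exact absurd h.1 (Finset.notMem_empty _)
  · exact fun h => h.elim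

/-- If `m + 1` is not an east label it is a fixed record, and only `m` drops; otherwise one round
matches one reduction. East labels exceed `1`, so nothing is left for `m = 0`, which also proves
that the sequence ends. -/
theorem RowShape.polyominoEdges_eq_permNetwork : ∀ {m : ℕ} {π : Equiv.Perm ℤ} {P : Finset Cell}
    {h : ℤ} {R : ℕ} {l e : ℕ → ℤ}, RowShape P h R l e → Link m π R l e →
    (∃ k, reduce^[k] P = ∅) ∧ polyominoEdges P = permNetwork m π := by
  intro m
  induction m with
  | zero =>
    intro π P h R l e S hL
    have hP : P = ∅ := by
      rw [Finset.eq_empty_iff_forall_notMem]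
      intro c hc
      obtain ⟨i, hi, _⟩ := S.mem_cell hc
      have h1 := hL.le i hi
      have h2 := S.one_lt_rowLabel hi
      simp only [Nat.cast_zero] at h1
      omega
    subst hP
    exact ⟨⟨0, rfl⟩, by rw [polyominoEdges_empty, permNetwork_zero]⟩
  | succ m ih =>
    intro π P h R l e S hL
    by_cases hE : ∃ i < R, rowLabel e i = (m : ℤ) + 1
    · obtain ⟨i, hi, him⟩ := hE
      obtain ⟨q, hq⟩ := exists_isTopRow e (show 0 < R by omega)
      have hm : rowLabel e q = (m : ℤ) + 1 := by
        have h1 := hq.rowLabel_le hi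
        have h2 := hL.le q hq.lt
        push_cast at h2
        omega
      obtain ⟨π', hp, hr, hnet⟩ := exists_round hL.perm
      obtain ⟨R', S', hR'⟩ := S.exists_reduce hq
      obtain ⟨⟨k, hk⟩, hedges⟩ := ih S' (S.link_reduce hq hL hm hp hr hR')
      refine ⟨⟨k + 1, hk⟩, ?_⟩
      rw [polyominoEdges_eq, hedges, hnet, S.roundEdges_eq hq hL hm]
    · push Not at hE
      have hfix := hL.perm.last_fixed (hL.zero _ (by omega) (by push_cast; omega)
        fun i hi h1 => hE i hi h1.symm)
      rw [permNetwork_last hfix]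
      refine ih S ⟨hL.perm.pred hfix, ?_, hL.position, hL.code, ?_⟩
      · intro i hi
        have h1 := hL.le i hi
        have h2 := hE i hi
        push_cast at h1
        omega
      · intro v h1 h2 hv
        exact hL.zero v h1 (by push_cast; omega) hv

/-! ### The rows of an admissible polyomino -/

lemma Connected.exists_adjacent {A : Set Cell} (hA : Connected A) {Q : Cell → Prop} {a b : Cell}
    (ha : a ∈ A) (hb : b ∈ A) (hQa : Q a) (hQb : ¬ Q b) :
    ∃ u ∈ A, ∃ v ∈ A, Adjacent u v ∧ Q u ∧ ¬ Q v := by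
  have key : ∀ c, Relation.ReflTransGen (fun u v => Adjacent u v ∧ v ∈ A) a c →
      c ∈ A ∧ (¬ Q c → ∃ u ∈ A, ∃ v ∈ A, Adjacent u v ∧ Q u ∧ ¬ Q v) := by
    intro c hc
    induction hc with
    | refl => exact ⟨ha, fun h => absurd hQa h⟩
    | @tail u v _ h2 ih =>
      refine ⟨h2.2, fun h3 => ?_⟩
      by_cases h4 : Q u
      · exact ⟨_, ih.1, _, h2.2, h2.1, h4, h3⟩
      · exact ih.2 h4
  exact (key b (hA a ha b hb)).2 hQb

lemma exists_last_of_int {p : ℤ → Prop} {r t : ℤ} (h : r ≤ t) (hr : p r) (ht : ¬ p t) :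
    ∃ u, r ≤ u ∧ u < t ∧ p u ∧ ¬ p (u + 1) := by
  induction t, h using Int.leInduction with
  | base => exact absurd hr ht
  | succ n hn ih =>
    by_cases h1 : p n
    · exact ⟨n, hn, by omega, h1, ht⟩
    · obtain ⟨u, h2, h3, h4⟩ := ih h1
      exact ⟨u, h2, by omega, h4⟩

namespace IsAdmissible

variable {P : Finset Cell} (hP : IsAdmissible P)

lemma exists_bounds (P : Finset Cell) : ∃ B T : ℤ, ∀ c ∈ P, B < c.2 ∧ c.2 < T := by
  obtain ⟨T, hT⟩ := (P.image Prod.snd).bddAbove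
  obtain ⟨B, hB⟩ := (P.image Prod.snd).bddBelow
  refine ⟨B - 1, T + 1, fun c hc => ?_⟩
  have h1 := Finset.mem_image_of_mem Prod.snd hc
  have h2 := hT (Finset.mem_coe.2 h1)
  have h3 := hB (Finset.mem_coe.2 h1)
  omega

lemma exists_northEdge {c r t : ℤ} (hr : (c, r) ∈ P) (ht : (c, t) ∉ P) (hrt : r ≤ t) :
    ∃ u, r ≤ u ∧ u < t ∧ (c, u) ∈ northEdges P := by
  obtain ⟨u, h1, h2, h3, h4⟩ := exists_last_of_int (p := fun u => (c, u) ∈ P) hrt hr ht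
  exact ⟨u, h1, h2, Finset.mem_filter.2 ⟨h3, h4⟩⟩

lemma exists_southEdge {c r t : ℤ} (hr : (c, r) ∈ P) (ht : (c, t) ∉ P) (hrt : t ≤ r) :
    ∃ u, t < u ∧ u ≤ r ∧ (c, u) ∈ southEdges P := by
  obtain ⟨u, h1, h2, h3, h4⟩ :=
    exists_last_of_int (p := fun u => (c, u) ∉ P) hrt ht (not_not.2 hr)
  exact ⟨u + 1, by omega, by omega, Finset.mem_filter.2 ⟨not_not.1 h4, by simpa using h3⟩⟩

lemma exists_southEdge_le {c r : ℤ} (hr : (c, r) ∈ P) :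
    ∃ u ≤ r, (c, u) ∈ southEdges P := by
  obtain ⟨B, T, hB⟩ := exists_bounds P
  have h1 := hB _ hr
  obtain ⟨u, _, h2⟩ := exists_southEdge hr (t := B) (fun h => by have := hB _ h; omega)
    (by simp only at h1; omega)
  exact ⟨u, h2⟩

include hP

/-- A missing square would leave a north edge in column `c` below a north edge further right. -/
lemma mem_of_right_higher {c r c' r' t : ℤ} (h1 : (c, r) ∈ P) (h2 : (c', r') ∈ P) (hc : c < c')
    (hr : r ≤ t) (ht : t ≤ r') : (c, t) ∈ P := by
  by_contra hcon
  obtain ⟨u, h3, h4, h5⟩ := exists_northEdge h1 hcon hr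
  obtain ⟨B, T, hB⟩ := exists_bounds P
  have h6 := hB _ h2
  obtain ⟨v, h7, h8, h9⟩ := exists_northEdge h2 (t := T) (fun h => by have := hB _ h; omega)
    (by simp only at h6; omega)
  have := hP.north _ h5 _ h9 hc
  simp only at this
  omega

lemma no_peak {x y z a b c : ℤ} (hxy : x < y) (hyz : y < z) (ha : (x, a) ∈ southEdges P)
    (hb : (y, b) ∈ southEdges P) (hc : (z, c) ∈ southEdges P) (hab : a < b) : b ≤ c := by
  obtain ⟨k, h1, h2⟩ := hP.south
  rcases le_or_gt y k with h3 | h3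
  · have := h1 _ ha _ hb hxy h3
    simp only at this
    omega
  · exact h2 _ hb _ hc h3.le hyz

lemma exists_mem_column {a b c r s : ℤ} (ha : (a, r) ∈ P) (hb : (b, s) ∈ P) (h1 : a < c)
    (h2 : c ≤ b) : ∃ t, (c, t) ∈ P := by
  obtain ⟨u, _, v, hv, h3, h4, h5⟩ := hP.connected.exists_adjacent (Q := fun u => u.1 < c)
    (Finset.mem_coe.2 ha) (Finset.mem_coe.2 hb) h1 (by simp only; omega)
  obtain ⟨x, t⟩ := v
  obtain rfl : x = c := by
    rcases h3 with ⟨h6, _⟩ | ⟨_, h6⟩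
    · simp only at h4 h5 h6
      omega
    · rcases abs_cases (u.1 - x) <;> simp only at h4 h5 h6 <;> omega
  exact ⟨t, hv⟩

lemma exists_mem_row_pair {a b c r t : ℤ} (ha : (a, r) ∈ P) (hb : (b, c) ∈ P) (h1 : t < r)
    (h2 : c ≤ t) : ∃ x, (x, t + 1) ∈ P ∧ (x, t) ∈ P := by
  obtain ⟨u, hu, v, hv, h3, h4, h5⟩ := hP.connected.exists_adjacent (Q := fun u => t < u.2)
    (Finset.mem_coe.2 ha) (Finset.mem_coe.2 hb) h1 (by simp only; omega)
  obtain ⟨x, y⟩ := u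
  obtain ⟨x', y'⟩ := v
  have h6 : x = x' ∧ y = t + 1 ∧ y' = t := by
    rcases h3 with ⟨h6, h7⟩ | ⟨h6, h7⟩
    · rcases abs_cases (y - y') <;> simp only at h4 h5 h6 h7 <;> omega
    · simp only at h4 h5 h6
      omega
  obtain ⟨rfl, rfl, rfl⟩ := h6
  exact ⟨x, hu, hv⟩

/-- By connectedness the column of a gap contains a square. If it is below the gap,
`mem_of_right_higher` fills the gap; if above, its column has a south edge above height `r` between
two columns with lower ones, a peak. -/
lemma row_convex {a b c r : ℤ} (ha : (a, r) ∈ P) (hb : (b, r) ∈ P) (h1 : a ≤ c) (h2 : c ≤ b) :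
    (c, r) ∈ P := by
  rcases h1.eq_or_lt with rfl | h1
  · exact ha
  rcases h2.eq_or_lt with rfl | h2
  · exact hb
  obtain ⟨t, ht⟩ := hP.exists_mem_column ha hb h1 h2.le
  by_contra hcon
  rcases le_or_gt t r with h3 | h3
  · exact hcon (hP.mem_of_right_higher ht hb h2 h3 le_rfl)
  · obtain ⟨u, h4, _, h5⟩ := exists_southEdge ht hcon h3.le
    obtain ⟨v, h6, h7⟩ := exists_southEdge_le ha
    obtain ⟨w, h8, h9⟩ := exists_southEdge_le hb
    have := hP.no_peak h1 h2 h7 h5 h9 (by omega)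
    omega

theorem exists_rowShape : ∃ (h : ℤ) (R : ℕ) (l e : ℕ → ℤ), RowShape P h R l e ∧ 0 < R ∧ l 0 = 1 ∧
    ∀ i, i + 1 < R → l (i + 1) ≤ e i := by
  obtain ⟨top, htop, hmax⟩ := Finset.exists_max_image P Prod.snd hP.nonempty
  obtain ⟨bot, hbot, hmin⟩ := Finset.exists_min_image P Prod.snd hP.nonempty
  obtain ⟨xt, h⟩ := top
  obtain ⟨xb, b⟩ := bot
  simp only at hmax hmin
  have hbh : b ≤ h := hmax _ hbot
  have hrow : ∀ i : ℕ, i < (h - b + 1).toNat → ∃ x y : ℤ, (x, h - (i : ℤ)) ∈ P ∧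
      (y, h - (i : ℤ)) ∈ P ∧ ∀ c, (c, h - (i : ℤ)) ∈ P → x ≤ c ∧ c ≤ y := by
    intro i hi
    have hne : (P.filter fun c => c.2 = h - (i : ℤ)).Nonempty := by
      rcases Nat.eq_zero_or_pos i with rfl | hpos
      · exact ⟨_, Finset.mem_filter.2 ⟨htop, by simp⟩⟩
      · obtain ⟨x, _, hx⟩ := hP.exists_mem_row_pair htop hbot (t := h - i) (by omega) (by omega)
        exact ⟨_, Finset.mem_filter.2 ⟨hx, rfl⟩⟩
    obtain ⟨x, hx, hx'⟩ := Finset.exists_min_image _ Prod.fst hne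
    obtain ⟨y, hy, hy'⟩ := Finset.exists_max_image _ Prod.fst hne
    rw [Finset.mem_filter] at hx hy
    refine ⟨x.1, y.1, ?_, ?_, fun c hc => ⟨hx' (c, _) (Finset.mem_filter.2 ⟨hc, rfl⟩),
      hy' (c, _) (Finset.mem_filter.2 ⟨hc, rfl⟩)⟩⟩
    · rw [← hx.2]
      exact hx.1
    · rw [← hy.2]
      exact hy.1
  set R := (h - b + 1).toNat with hR
  choose! l e hl he hle using hrow
  have hmono : ∀ i j, i ≤ j → j < R → l i ≤ l j := by
    intro i j hij
    induction j, hij using Nat.le_induction with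
    | base => exact fun _ => le_rfl
    | succ j hij ih =>
      intro hj
      refine (ih (by omega)).trans ?_
      have h1 := hl (j + 1) hj
      -- A square above row `j + 1` and right of its start fills column `l (j + 1)` up to row `j`;
      -- without such squares row `j` lies weakly left of that column.
      by_cases h2 : ∃ c ∈ P, h - ((j + 1 : ℕ) : ℤ) < c.2 ∧ l (j + 1) < c.1
      · obtain ⟨⟨x, y⟩, hc, h3, h4⟩ := h2
        have h5 := hP.mem_of_right_higher (t := h - (j : ℤ)) h1 hc h4 (by push_cast; omega)
          (by push_cast at h3; omega)
        exact (hle j (by omega) _ h5).1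
      · push Not at h2
        exact h2 _ (hl j (by omega)) (by push_cast; omega)
  have hlee : ∀ i < R, l i ≤ e i := fun i hi => (hle i hi _ (he i hi)).1
  have hpos : ∀ i < R, 1 ≤ l i := fun i hi => hP.leftmost.1 _ (hl i hi)
  refine ⟨h, R, l, e, ⟨?_, hlee, hmono, hpos, ?_⟩, by omega, ?_, ?_⟩
  · intro c r
    constructor
    · intro hc
      have h1 := hmax _ hc
      have h2 := hmin _ hc
      simp only at h1 h2
      refine ⟨(h - r).toNat, by omega, by omega, ?_⟩
      apply hle _ (by omega)
      rwa [Int.toNat_of_nonneg (by omega), show h - (h - r) = r by omega]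
    · rintro ⟨i, hi, rfl, h1, h2⟩
      exact hP.row_convex (hl i hi) (he i hi) h1 h2
  · intro i j k hij hjk hk h1 h2
    have hj := he j (by omega)
    have hli := hmono i j hij.le (by omega)
    have hlj := hlee j (by omega)
    have hxi : (e j + 1, h - (i : ℤ)) ∈ P :=
      hP.row_convex (hl i (by omega)) (he i (by omega)) (by omega) (by omega)
    have hxj : (e j + 1, h - (j : ℤ)) ∉ P := fun hx => by
      have := (hle j (by omega) _ hx).2
      omega
    -- Otherwise column `e j + 1`, which has a south edge above row `j`, is a peak between the
    -- columns `e j` and `e k`.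
    have hek : e k = e j + 1 := by
      by_contra hc
      obtain ⟨u, h4, _, h5⟩ := exists_southEdge hxi hxj (by omega)
      obtain ⟨v, h6, h7⟩ := exists_southEdge_le hj
      obtain ⟨w, h8, h9⟩ := exists_southEdge_le (he k hk)
      have := hP.no_peak (by omega) (by omega) h7 h5 h9 (by omega)
      omega
    refine ⟨?_, hek⟩
    by_contra hc
    have h3 := he k hk
    rw [hek] at h3
    -- If row `i` ended right of column `e k = e j + 1`, this column would be filled from row `k` up
    -- to row `i`, through row `j`.
    exact hxj (hP.mem_of_right_higher h3 (he i (by omega)) (by omega) (by omega) (by omega))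
  · obtain ⟨⟨x, y⟩, hc, h1⟩ := hP.leftmost.2
    simp only at h1
    subst h1
    have h2 := hmax _ hc
    have h3 := hmin _ hc
    simp only at h2 h3
    have h4 : (1, h - (((h - y).toNat : ℕ) : ℤ)) ∈ P := by
      rwa [Int.toNat_of_nonneg (by omega), show h - (h - y) = y by omega]
    have h5 := (hle _ (by omega) _ h4).1
    have h6 := hmono 0 _ (Nat.zero_le _) (show (h - y).toNat < R by omega)
    have h7 := hpos 0 (by omega)
    omega
  · intro i hi
    obtain ⟨x, h1, h2⟩ := hP.exists_mem_row_pair htop hbot (t := h - ((i + 1 : ℕ) : ℤ))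
      (by push_cast; omega) (by omega)
    have h3 := hle (i + 1) hi _ h2
    rw [show h - ((i + 1 : ℕ) : ℤ) + 1 = h - (i : ℤ) by push_cast; ring] at h1
    have h4 := hle i (by omega) _ h1
    omega

end IsAdmissible

/-! ### Sorted words -/

lemma oneLine_eq (n : ℕ) (π : Equiv.Perm ℤ) :
    oneLine n π = (List.range n).map fun k : ℕ => π ((k : ℤ) + 1) := by
  simp [oneLine, ← List.map_eq_flatMap]

/-- If the values on a finite linear order are `1, …, n`, the sorted word of values is the one-line
notation of a permutation. -/
theorem exists_perm_of_sort {α : Type*} [LinearOrder α] (Q : Finset α) (val : α → ℤ) (n : ℕ)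
    (hinj : Set.InjOn val Q) (himg : Q.image val = Finset.Icc 1 (n : ℤ)) :
    ∃ σ : Equiv.Perm ℤ, IsPermutation n σ ∧ (Q.sort (· ≤ ·)).map val = oneLine n σ ∧
      ∀ t ∈ Q, σ⁻¹ (val t) = ((Q.filter (· < t)).card : ℤ) + 1 := by
  have hn : Q.card = n := by
    rw [← Finset.card_image_of_injOn hinj, himg]
    simp
  set emb := Q.orderEmbOfFin hn with hemb
  have hembQ : ∀ k, emb k ∈ Q := Finset.orderEmbOfFin_mem Q hn
  have hval : ∀ t ∈ Q, 1 ≤ val t ∧ val t ≤ n := by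
    intro t ht
    rw [← Finset.mem_Icc, ← himg]
    exact Finset.mem_image_of_mem val ht
  set g : ℤ → ℤ := fun i => if h : 1 ≤ i ∧ i ≤ (n : ℤ) then val (emb ⟨(i - 1).toNat, by omega⟩) else i
    with hg
  have hgin : ∀ (i : ℤ) (h : 1 ≤ i ∧ i ≤ (n : ℤ)), g i = val (emb ⟨(i - 1).toNat, by omega⟩) :=
    fun i h => dif_pos h
  have hgout : ∀ i : ℤ, ¬ (1 ≤ i ∧ i ≤ (n : ℤ)) → g i = i := fun i h => dif_neg h
  have hbij : Function.Bijective g := by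
    constructor
    · intro i j hij
      by_cases hi : 1 ≤ i ∧ i ≤ (n : ℤ) <;> by_cases hj : 1 ≤ j ∧ j ≤ (n : ℤ)
      · rw [hgin i hi, hgin j hj] at hij
        have h1 := emb.injective (hinj (hembQ _) (hembQ _) hij)
        have h2 := congrArg Fin.val h1
        simp only at h2
        omega
      · rw [hgin i hi, hgout j hj] at hij
        rw [← hij] at hj
        exact absurd (hval _ (hembQ _)) hj
      · rw [hgout i hi, hgin j hj] at hij
        rw [hij] at hi
        exact absurd (hval _ (hembQ _)) hi
      · rwa [hgout i hi, hgout j hj] at hij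
    · intro v
      by_cases hv : 1 ≤ v ∧ v ≤ (n : ℤ)
      · rw [← Finset.mem_Icc, ← himg] at hv
        obtain ⟨t, ht, rfl⟩ := Finset.mem_image.1 hv
        have h1 : t ∈ Set.range emb := by rw [Finset.range_orderEmbOfFin]; exact ht
        obtain ⟨k, rfl⟩ := h1
        refine ⟨(k : ℤ) + 1, ?_⟩
        rw [hgin _ ⟨by omega, by omega⟩]
        congr 2
        ext
        simp
      · exact ⟨v, hgout v hv⟩
  have happ : ∀ k : Fin n, g ((k : ℤ) + 1) = val (emb k) := by
    intro k
    rw [hgin _ ⟨by omega, by omega⟩]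
    congr 2
    ext
    simp
  refine ⟨Equiv.ofBijective g hbij, fun i hi => hgout i hi, ?_, ?_⟩
  · apply List.ext_getElem
    · simp [oneLine_eq, hn]
    · intro k h1 h2
      have hk : k < n := by simpa [oneLine_eq] using h2
      have h3 := happ ⟨k, hk⟩
      simp only [oneLine_eq, List.getElem_map, List.getElem_range, Equiv.ofBijective_apply]
      rw [h3, hemb, Finset.orderEmbOfFin_apply]
      rfl
  · intro t ht
    have h1 : t ∈ Set.range emb := by rw [Finset.range_orderEmbOfFin]; exact ht
    obtain ⟨k, rfl⟩ := h1
    rw [Equiv.Perm.inv_eq_iff_eq]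
    have h2 : Q.filter (· < emb k) = (Finset.Iio k).map emb.toEmbedding := by
      ext u
      rw [Finset.mem_filter, Finset.mem_map]
      constructor
      · rintro ⟨h3, h4⟩
        have h5 : u ∈ Set.range emb := by rw [Finset.range_orderEmbOfFin]; exact h3
        obtain ⟨j, rfl⟩ := h5
        exact ⟨j, Finset.mem_Iio.2 (emb.lt_iff_lt.1 h4), rfl⟩
      · rintro ⟨j, h3, rfl⟩
        exact ⟨hembQ j, emb.lt_iff_lt.2 (Finset.mem_Iio.1 h3)⟩
    rw [h2, Finset.card_map, Fin.card_Iio]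
    exact (happ k).symm

namespace RowShape

variable {P : Finset Cell} {h : ℤ} {R q : ℕ} {l e : ℕ → ℤ} (S : RowShape P h R l e)
include S

/-! ### South edges of a connected polyomino -/

lemma southEdges_cell {s : Cell} (hs : s ∈ southEdges P) : ∃ i < R, s = (s.1, h - (i : ℤ)) := by
  obtain ⟨i, hi, h1, _⟩ := S.mem_cell (southEdges_subset hs)
  exact ⟨i, hi, h1⟩

/-- A south edge above another square of its column is covered and lies in the last column. -/
lemma covered_of_above {c : ℤ} {a b : ℕ} (ha : (c, h - (a : ℤ)) ∈ southEdges P)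
    (hb : (c, h - (b : ℤ)) ∈ P) (hab : a < b) :
    (c, h - (a : ℤ)) ∈ coveredEdges P ∧ ∀ k < R, e k ≤ c := by
  obtain ⟨h1, h2⟩ := S.southEdge_iff.1 ha
  have h3 := S.mem_row.1 hb
  have hb1 : a + 1 < b := by
    by_contra hc
    obtain rfl : b = a + 1 := by omega
    exact h2 h3
  have h4 := S.mono (a + 1) b hb1.le h3.1
  -- Row `a + 1` starts weakly left of `c` and misses it, so it is a dip ending in column `c - 1`;
  -- its label starts directly below the edge.
  have h5 := S.valley a (a + 1) b (by omega) hb1 h3.1 (by omega) (by omega)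
  refine ⟨S.mem_coveredEdges.2 ⟨ha, a + 1, by omega, by omega, ?_, fun x hx hx' => by omega⟩, ?_⟩
  · rw [show a + 1 - a - 1 = 0 by omega, labelColumn_zero]
    simp only
    omega
  · intro k hk
    by_contra hc
    rcases lt_trichotomy k (a + 1) with h6 | h6 | h6
    · have := S.valley k (a + 1) b h6 hb1 h3.1 (by omega) (by omega)
      omega
    · subst h6
      omega
    · have := S.valley a (a + 1) k (by omega) h6 hk (by omega) (by omega)
      omega

lemma freeEdges_inj {s s' : Cell} (hs : s ∈ freeEdges P) (hs' : s' ∈ freeEdges P)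
    (h1 : s.1 = s'.1) : s = s' := by
  unfold freeEdges at hs hs'
  rw [Finset.mem_sdiff] at hs hs'
  obtain ⟨i, _, h2⟩ := S.southEdges_cell hs.1
  obtain ⟨j, _, h3⟩ := S.southEdges_cell hs'.1
  rw [← h1] at h3
  rw [h2] at hs
  rw [h3] at hs'
  rcases lt_trichotomy i j with h4 | h4 | h4
  · exact absurd (S.covered_of_above hs.1 (southEdges_subset hs'.1) h4).1 hs.2
  · rw [h2, h3, h4]
  · exact absurd (S.covered_of_above hs'.1 (southEdges_subset hs.1) h4).1 hs'.2

omit S in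
lemma exists_row (h0 : l 0 = 1) (hov : ∀ i, i + 1 < R → l (i + 1) ≤ e i) {c : ℤ} (hc : 1 ≤ c) :
    ∀ {i : ℕ}, i < R → c ≤ e i → ∃ j ≤ i, l j ≤ c ∧ c ≤ e j := by
  intro i
  induction i with
  | zero => exact fun _ h1 => ⟨0, le_rfl, by omega, h1⟩
  | succ i ih =>
    intro hi h1
    by_cases h2 : l (i + 1) ≤ c
    · exact ⟨i + 1, le_rfl, h2, h1⟩
    · have := hov i hi
      obtain ⟨j, h3, h4⟩ := ih (by omega) (by omega)
      exact ⟨j, by omega, h4⟩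

/-- The lowest square of a column. -/
lemma exists_lowest (h0 : l 0 = 1) (hov : ∀ i, i + 1 < R → l (i + 1) ≤ e i) {c : ℤ} (hc : 1 ≤ c)
    {i : ℕ} (hi : i < R) (hci : c ≤ e i) : ∃ a : ℕ, (c, h - (a : ℤ)) ∈ southEdges P ∧
      ∀ b : ℕ, (c, h - (b : ℤ)) ∈ P → b ≤ a := by
  obtain ⟨j, hj, h1⟩ := exists_row h0 hov hc hi hci
  obtain ⟨a, ha, hmax⟩ := Finset.exists_max_image
    ((Finset.range R).filter fun i => l i ≤ c ∧ c ≤ e i) id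
    ⟨j, Finset.mem_filter.2 ⟨Finset.mem_range.2 (by omega), h1⟩⟩
  rw [Finset.mem_filter, Finset.mem_range] at ha
  have hb : ∀ b : ℕ, (c, h - (b : ℤ)) ∈ P → b ≤ a := by
    intro b hb
    have h2 := S.mem_row.1 hb
    exact hmax b (Finset.mem_filter.2 ⟨Finset.mem_range.2 h2.1, h2.2⟩)
  refine ⟨a, S.southEdge_iff.2 ⟨ha, fun h2 => ?_⟩, hb⟩
  have := hb _ (S.mem_row.2 h2)
  omega

/-- Every column left of `s` has exactly one south edge, since by `covered_of_above` only the last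
column can have more. Subtracting the covered ones leaves the free ones. -/
lemma southIndex_eq_card (h0 : l 0 = 1) (hov : ∀ i, i + 1 < R → l (i + 1) ≤ e i) {s : Cell}
    (hs : s ∈ P) :
    southIndex P s = ((freeEdges P).filter fun s' => s'.1 < s.1).card + 1 := by
  classical
  obtain ⟨i, hi, hsi, h1, h2⟩ := S.mem_cell hs
  have hcov : coveredEdges P ⊆ southEdges P := by
    unfold coveredEdges
    exact Finset.filter_subset _ _
  have hcount : ((southEdges P).filter fun s' => s'.1 < s.1).card = (s.1 - 1).toNat := by
    have himg : ((southEdges P).filter fun s' => s'.1 < s.1).image Prod.fst =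
        Finset.Icc 1 (s.1 - 1) := by
      ext c
      rw [Finset.mem_image, Finset.mem_Icc]
      constructor
      · rintro ⟨s', hs', rfl⟩
        rw [Finset.mem_filter] at hs'
        obtain ⟨j, hj, _, h3, _⟩ := S.mem_cell (southEdges_subset hs'.1)
        have := S.pos j hj
        omega
      · rintro ⟨h3, h4⟩
        obtain ⟨a, ha, _⟩ := S.exists_lowest h0 hov h3 hi (by omega)
        exact ⟨_, Finset.mem_filter.2 ⟨ha, by simp only; omega⟩, rfl⟩
    have hinj : Set.InjOn Prod.fst
        (((southEdges P).filter fun s' => s'.1 < s.1 : Finset Cell) : Set Cell) := by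
      intro x hx y hy hxy
      rw [Finset.mem_coe, Finset.mem_filter] at hx hy
      obtain ⟨a, _, h3⟩ := S.southEdges_cell hx.1
      obtain ⟨b, _, h4⟩ := S.southEdges_cell hy.1
      rw [← hxy] at h4
      have hx' := hx.1
      have hy' := hy.1
      rw [h3] at hx'
      rw [h4] at hy'
      rcases lt_trichotomy a b with h5 | h5 | h5
      · have := (S.covered_of_above hx' (southEdges_subset hy') h5).2 i hi
        omega
      · rw [h3, h4, h5]
      · have := (S.covered_of_above hy' (southEdges_subset hx') h5).2 i hi
        omega
    rw [← Finset.card_image_of_injOn hinj, himg, Int.card_Icc]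
    omega
  have hsplit : ((coveredEdges P).filter fun s' => s'.1 < s.1).card +
      ((freeEdges P).filter fun s' => s'.1 < s.1).card = (s.1 - 1).toNat := by
    rw [← hcount, ← Finset.card_union_of_disjoint, ← Finset.filter_union]
    · unfold freeEdges
      rw [Finset.union_sdiff_of_subset hcov]
    · unfold freeEdges
      exact Finset.disjoint_filter_filter Finset.disjoint_sdiff
  have := S.pos i hi
  unfold southIndex
  omega

lemma southIndex_lt_iff (h0 : l 0 = 1) (hov : ∀ i, i + 1 < R → l (i + 1) ≤ e i) {s s' : Cell}
    (hs : s ∈ freeEdges P) (hs' : s' ∈ freeEdges P) :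
    southIndex P s < southIndex P s' ↔ s.1 < s'.1 := by
  rw [S.southIndex_eq_card h0 hov (freeEdges_subset hs),
    S.southIndex_eq_card h0 hov (freeEdges_subset hs')]
  constructor
  · intro h1
    by_contra hc
    have : ((freeEdges P).filter fun t => t.1 < s'.1) ⊆ (freeEdges P).filter fun t => t.1 < s.1 := by
      intro t ht
      rw [Finset.mem_filter] at ht ⊢
      exact ⟨ht.1, by omega⟩
    have := Finset.card_le_card this
    omega
  · intro h1
    have : ((freeEdges P).filter fun t => t.1 < s.1) ⊂ (freeEdges P).filter fun t => t.1 < s'.1 := by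
      rw [Finset.ssubset_iff_of_subset]
      · exact ⟨s, Finset.mem_filter.2 ⟨hs, h1⟩, fun h2 => by
          have := (Finset.mem_filter.1 h2).2
          omega⟩
      · intro t ht
        rw [Finset.mem_filter] at ht ⊢
        exact ⟨ht.1, by omega⟩
    have := Finset.card_lt_card this
    omega

lemma southIndex_mem (h0 : l 0 = 1) (hov : ∀ i, i + 1 < R → l (i + 1) ≤ e i) {s : Cell}
    (hs : s ∈ freeEdges P) : 1 ≤ southIndex P s ∧ southIndex P s ≤ (freeEdges P).card := by
  rw [S.southIndex_eq_card h0 hov (freeEdges_subset hs)]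
  have : ((freeEdges P).filter fun t => t.1 < s.1) ⊂ freeEdges P := by
    rw [Finset.ssubset_iff_of_subset (Finset.filter_subset _ _)]
    exact ⟨s, hs, fun h2 => lt_irrefl _ (Finset.mem_filter.1 h2).2⟩
  have := Finset.card_lt_card this
  omega

/-- There are enough south labels to fill the gaps below the maximal east label. -/
lemma le_card_freeEdges (hq : IsTopRow R e q) (h0 : l 0 = 1)
    (hov : ∀ i, i + 1 < R → l (i + 1) ≤ e i) :
    e q - ((R : ℤ) - 1 - q) ≤ (freeEdges P).card := by
  have hqR := hq.lt
  have hle : (Finset.Icc 1 (e q)).card ≤ ((freeEdges P).disjSum (Finset.Ioo q R)).card := by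
    -- The lowest south edge of each of the columns `1, …, e q` is free or covered by a row below
    -- `q`, and a row covers at most one edge.
    apply Finset.card_le_card_of_forall_subsingleton (fun (c : ℤ) (y : Cell ⊕ ℕ) => Sum.elim
      (fun s : Cell => s.1 = c)
      (fun j => ∃ a : ℕ, (c, h - (a : ℤ)) ∈ P ∧ Covers P h e j a c) y)
    · intro c hc
      rw [Finset.mem_Icc] at hc
      obtain ⟨a, ha, hlow⟩ := S.exists_lowest h0 hov hc.1 hqR hc.2
      by_cases hcov : (c, h - (a : ℤ)) ∈ coveredEdges P
      · obtain ⟨_, j, hj, hcj⟩ := S.mem_coveredEdges.1 hcov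
        refine ⟨Sum.inr j, Finset.inr_mem_disjSum.2 (Finset.mem_Ioo.2 ⟨?_, hj⟩), a,
          southEdges_subset ha, hcj⟩
        -- A row `j ≤ q` covers nothing left of `e q`; and in column `e q` the lowest square is in
        -- row `q` or below, hence not above row `j`.
        by_contra hcon
        have h1 := (S.le_of_covers (southEdges_subset ha) hcj (k := q) (by omega) hqR).1
        obtain rfl : c = e q := by omega
        have h2 := hlow q (S.mem_row.2 ⟨hqR, S.le q hqR, le_rfl⟩)
        have h3 := hcj.1
        omega
      · exact ⟨Sum.inl _, Finset.inl_mem_disjSum.2 (Finset.mem_sdiff.2 ⟨ha, hcov⟩), rfl⟩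
    · rintro (s | j) hy c ⟨_, hc⟩ c' ⟨_, hc'⟩
      · exact hc.symm.trans hc'
      · obtain ⟨a, h1, h2⟩ := hc
        obtain ⟨a', h1', h2'⟩ := hc'
        have hj := (Finset.mem_Ioo.1 (Finset.inr_mem_disjSum.1 hy)).2
        rcases le_total a a' with h3 | h3
        · exact (S.covers_unique hj h1' h1 h2' h2 h3).2
        · exact (S.covers_unique hj h1 h1' h2 h2' h3).2.symm
  rw [Finset.card_disjSum, Int.card_Icc, Nat.card_Ioo] at hle
  omega

lemma southLabelHeight_of_ge {c : ℤ} {a : ℕ} (ha : a < R) (hc : l (R - 1) ≤ c) :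
    southLabelHeight P (c, h - (a : ℤ)) = h - R := by
  unfold southLabelHeight
  have hlow : (l (R - 1), h - ((R - 1 : ℕ) : ℤ)) ∈ P :=
    S.mem_row.2 ⟨by omega, le_rfl, S.le _ (by omega)⟩
  rw [if_pos ⟨(l (R - 1), h - ((R - 1 : ℕ) : ℤ)),
    S.mem_lowestCells.2 ⟨by omega, le_rfl, S.le _ (by omega), rfl⟩, hc⟩]
  have hsup : (P.sup fun b : Cell => ((c, h - (a : ℤ)).2 - b.2).toNat) = R - 1 - a := by
    apply le_antisymm
    · apply Finset.sup_le
      intro b hb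
      obtain ⟨i, hi, h1, _⟩ := S.mem_cell hb
      rw [h1]
      simp only
      omega
    · have := Finset.le_sup (f := fun b : Cell => ((c, h - (a : ℤ)).2 - b.2).toNat) hlow
      simp only at this
      simp only
      omega
  rw [hsup]
  simp only
  omega

/-! ### The order of the labels -/

/-- The east label of row `i` with its place. -/
def _root_.PolyNet.eastKey (h : ℤ) (e : ℕ → ℤ) (i : ℕ) : ℤ ×ₗ ℤ ×ₗ ℤ :=
  toLex (-(h - (i : ℤ)), toLex (e i + 1, rowLabel e i))

/-- The south label of `s` with its place. -/
noncomputable def _root_.PolyNet.southKey (P : Finset Cell) (s : Cell) : ℤ ×ₗ ℤ ×ₗ ℤ :=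
  toLex (-southLabelHeight P s, toLex (s.1, southLabel P s))

lemma placedLabels_eq : placedLabels P =
    (Finset.range R).image (eastKey h e) ∪ (freeEdges P).image (southKey P) := by
  unfold placedLabels
  congr 1
  ext t
  rw [Finset.mem_image, Finset.mem_image]
  constructor
  · rintro ⟨c, hc, rfl⟩
    obtain ⟨i, hi, rfl⟩ := S.mem_eastEdges.1 hc
    refine ⟨i, Finset.mem_range.2 hi, ?_⟩
    rw [S.eastLabel_eq hi]
    rfl
  · rintro ⟨i, hi, rfl⟩
    rw [Finset.mem_range] at hi
    refine ⟨_, S.mem_eastEdges.2 ⟨i, hi, rfl⟩, ?_⟩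
    rw [S.eastLabel_eq hi]
    rfl

omit S in
lemma _root_.PolyNet.eastKey_lt {i j : ℕ} : eastKey h e i < eastKey h e j ↔ i < j := by
  unfold eastKey
  rw [Prod.Lex.toLex_lt_toLex]
  constructor
  · rintro (h1 | ⟨h1, h2⟩)
    · simp only at h1
      omega
    · simp only at h1
      obtain rfl : i = j := by omega
      exact absurd h2 (lt_irrefl _)
  · intro h1
    left
    simp only
    omega

/-- The square above a south label that is left of the lowest row. -/
lemma free_left {s : Cell} (hs : s ∈ freeEdges P) (hl : s.1 < l (R - 1)) :
    ∃ a : ℕ, a + 1 < R ∧ l a ≤ s.1 ∧ s.1 < l (a + 1) ∧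
      southLabelHeight P s = h - (a : ℤ) - 1 := by
  have hs' := (Finset.mem_sdiff.1 (show s ∈ southEdges P \ coveredEdges P from hs)).1
  obtain ⟨a, ha, h1⟩ := S.southEdges_cell hs'
  rw [h1] at hs'
  obtain ⟨h2, h3⟩ := S.southEdge_iff.1 hs'
  have hle := S.le (R - 1) (by omega)
  have haR : a + 1 < R := by
    by_contra hc
    obtain rfl : a = R - 1 := by omega
    omega
  refine ⟨a, haR, h2.2.1, ?_, by rw [h1]; exact S.southLabelHeight_of_lt hl⟩
  by_contra hc
  have h4 : e (a + 1) < s.1 := by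
    by_contra h5
    exact h3 ⟨haR, by omega, by omega⟩
  rcases (show a + 1 ≤ R - 1 by omega).eq_or_lt with h5 | h5
  · rw [h5] at h4
    omega
  · have := S.valley a (a + 1) (R - 1) (by omega) h5 (by omega) (by omega) (by omega)
    omega

lemma free_right {s : Cell} (hs : s ∈ freeEdges P) (hl : l (R - 1) ≤ s.1) :
    southLabelHeight P s = h - R := by
  obtain ⟨a, ha, h1, _⟩ := S.mem_cell (freeEdges_subset hs)
  rw [h1]
  exact S.southLabelHeight_of_ge ha hl

/-- Left of the lowest row, a south label is written at the height of the first row that starts to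
its right, and in that row it precedes the east label. The other south labels come after all east
labels. -/
lemma southKey_lt_eastKey {s : Cell} (hs : s ∈ freeEdges P) {i : ℕ} (hi : i < R) :
    southKey P s < eastKey h e i ↔ s.1 < l i := by
  unfold southKey eastKey
  rw [Prod.Lex.toLex_lt_toLex, Prod.Lex.toLex_lt_toLex]
  simp only
  have hli := S.mono i (R - 1) (by omega) (by omega)
  rcases lt_or_ge s.1 (l (R - 1)) with hl | hl
  · obtain ⟨a, ha, h1, h2, h3⟩ := S.free_left hs hl
    rw [h3]
    constructor
    · intro h4
      have := S.mono (a + 1) i (by omega) hi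
      omega
    · intro h4
      by_contra hc
      rcases (show i ≤ a ∨ i = a + 1 by omega) with h5 | h5
      · have := S.mono i a h5 (by omega)
        omega
      · have := S.le i hi
        omega
  · rw [S.free_right hs hl]
    omega

lemma southKey_lt_southKey {s s' : Cell} (hs : s ∈ freeEdges P) (hs' : s' ∈ freeEdges P)
    (hlt : s.1 < s'.1) : southKey P s < southKey P s' := by
  unfold southKey
  rw [Prod.Lex.toLex_lt_toLex, Prod.Lex.toLex_lt_toLex]
  simp only
  rcases lt_or_ge s'.1 (l (R - 1)) with hl | hl
  · obtain ⟨a, ha, h1, h2, h3⟩ := S.free_left hs (hlt.trans hl)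
    obtain ⟨a', ha', h1', h2', h3'⟩ := S.free_left hs' hl
    rw [h3, h3']
    have : a ≤ a' := by
      by_contra hc
      have := S.mono (a' + 1) a (by omega) (by omega)
      omega
    omega
  · rw [S.free_right hs' hl]
    rcases lt_or_ge s.1 (l (R - 1)) with hl' | hl'
    · obtain ⟨a, ha, h1, h2, h3⟩ := S.free_left hs hl'
      rw [h3]
      omega
    · rw [S.free_right hs hl']
      omega

/-! ### The word of a polyomino -/

/-- The rows from `i` down do not move a label in the column of `s`, so the two labels can be
compared when the rows above `i` are left. -/
lemma southLabel_lt_rowLabel {s : Cell} (hs : s ∈ freeEdges P) {i : ℕ} (hi : i < R)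
    (hl : s.1 < l i) : southLabel P s < rowLabel e i := by
  obtain ⟨a, ha, _, h1, _⟩ := S.mem_cell (freeEdges_subset hs)
  have h2 : ∀ j, i ≤ j → j < R → s.1 ≤ e j := by
    intro j hij hj
    have := S.mono i j hij hj
    have := S.le j hj
    omega
  have h3 := S.southIndex_of_le (by omega) (c := s) (h2 (R - 1) (by omega) (by omega))
  have h4 := S.pos a ha
  rw [S.southLabel_eq (by omega), h3, up_of_le hi.le h2, rowLabel, up_lt_up]
  have := h2 i le_rfl hi
  omega

/-- Each column left of `l i` has a south edge, and it is free, since covered edges lie weakly right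
of `e (R - 1) ≥ l i`. -/
lemma card_free_left (h0 : l 0 = 1) (hov : ∀ i, i + 1 < R → l (i + 1) ≤ e i) {i : ℕ}
    (hi : i < R) : (((freeEdges P).filter fun s => s.1 < l i).card : ℤ) = l i - 1 := by
  have himg : ((freeEdges P).filter fun s => s.1 < l i).image Prod.fst =
      Finset.Icc 1 (l i - 1) := by
    ext c
    rw [Finset.mem_image, Finset.mem_Icc]
    constructor
    · rintro ⟨s, hs, rfl⟩
      rw [Finset.mem_filter] at hs
      obtain ⟨j, hj, _, h3, _⟩ := S.mem_cell (freeEdges_subset hs.1)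
      have := S.pos j hj
      omega
    · rintro ⟨h3, h4⟩
      have h5 := S.le i hi
      obtain ⟨a, ha, _⟩ := S.exists_lowest h0 hov h3 hi (by omega)
      refine ⟨_, Finset.mem_filter.2 ⟨Finset.mem_sdiff.2 ⟨ha, fun hcov => ?_⟩,
        by simp only; omega⟩, rfl⟩
      obtain ⟨_, j, hj, hcj⟩ := S.mem_coveredEdges.1 hcov
      have h6 := (S.le_of_covers (southEdges_subset ha) hcj (k := R - 1) (by omega) (by omega)).1
      have h7 := S.mono i (R - 1) (by omega) (by omega)
      have h8 := S.le (R - 1) (by omega)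
      omega
  have hinj : Set.InjOn Prod.fst
      (((freeEdges P).filter fun s => s.1 < l i : Finset Cell) : Set Cell) := by
    intro x hx y hy hxy
    rw [Finset.mem_coe, Finset.mem_filter] at hx hy
    exact S.freeEdges_inj hx.1 hy.1 hxy
  rw [← Finset.card_image_of_injOn hinj, himg, Int.card_Icc]
  have := S.pos i hi
  omega

lemma southLabel_lt_iff (h0 : l 0 = 1) (hov : ∀ i, i + 1 < R → l (i + 1) ≤ e i) {s s' : Cell}
    (hs : s ∈ freeEdges P) (hs' : s' ∈ freeEdges P) :
    southLabel P s < southLabel P s' ↔ s.1 < s'.1 := by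
  rw [S.southLabel_eq (S.southIndex_mem h0 hov hs).1, S.southLabel_eq (S.southIndex_mem h0 hov hs').1,
    up_lt_up, S.southIndex_lt_iff h0 hov hs hs']

lemma southLabel_injOn (h0 : l 0 = 1) (hov : ∀ i, i + 1 < R → l (i + 1) ≤ e i) :
    Set.InjOn (southLabel P) (freeEdges P) := by
  intro s hs s' hs' heq
  apply S.freeEdges_inj hs hs'
  have h1 := S.southLabel_lt_iff h0 hov hs hs'
  have h2 := S.southLabel_lt_iff h0 hov hs' hs
  omega

lemma southLabel_ne_rowLabel (h0 : l 0 = 1) (hov : ∀ i, i + 1 < R → l (i + 1) ≤ e i) {s : Cell}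
    (hs : s ∈ freeEdges P) {i : ℕ} (hi : i < R) : southLabel P s ≠ rowLabel e i := by
  rw [S.southLabel_eq (S.southIndex_mem h0 hov hs).1]
  exact up_ne_rowLabel hi _

/-- The value of a label with its place. -/
def _root_.PolyNet.labelValue (t : ℤ ×ₗ ℤ ×ₗ ℤ) : ℤ := (ofLex (ofLex t).2).2

omit S in
lemma _root_.PolyNet.labelValue_eastKey (i : ℕ) : labelValue (eastKey h e i) = rowLabel e i := rfl

omit S in
lemma _root_.PolyNet.labelValue_southKey (s : Cell) : labelValue (southKey P s) = southLabel P s :=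
  rfl

lemma card_labels (h0 : l 0 = 1) (hov : ∀ i, i + 1 < R → l (i + 1) ≤ e i) {A : Finset ℕ}
    {B : Finset Cell} (hA : ∀ i ∈ A, i < R) (hB : B ⊆ freeEdges P) :
    (A.image (rowLabel e) ∪ B.image (southLabel P)).card = A.card + B.card := by
  rw [Finset.card_union_of_disjoint, Finset.card_image_of_injective _ (rowLabel_injective e),
    Finset.card_image_of_injOn ((S.southLabel_injOn h0 hov).mono (Finset.coe_subset.2 hB))]
  rw [Finset.disjoint_left]
  intro v hv hv'
  obtain ⟨i, hi, rfl⟩ := Finset.mem_image.1 hv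
  obtain ⟨s, hs, h1⟩ := Finset.mem_image.1 hv'
  exact S.southLabel_ne_rowLabel h0 hov (hB hs) (hA i hi) h1

lemma image_labelValue : (placedLabels P).image labelValue =
    (Finset.range R).image (rowLabel e) ∪ (freeEdges P).image (southLabel P) := by
  rw [S.placedLabels_eq, Finset.image_union, Finset.image_image, Finset.image_image]
  rfl

/-- The labels are distinct, so it suffices that none exceeds their number. For east labels this is
`le_card_freeEdges`; a south label exceeds its index by at most `R`. -/
lemma image_labelValue_eq (hR : 0 < R) (h0 : l 0 = 1) (hov : ∀ i, i + 1 < R → l (i + 1) ≤ e i) :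
    (placedLabels P).image labelValue = Finset.Icc 1 ((R + (freeEdges P).card : ℕ) : ℤ) := by
  obtain ⟨q, hq⟩ := exists_isTopRow e hR
  apply Finset.eq_of_subset_of_card_le
  · rw [S.image_labelValue]
    intro v hv
    rw [Finset.mem_Icc]
    push_cast
    rcases Finset.mem_union.1 hv with hv | hv
    · obtain ⟨i, hi, rfl⟩ := Finset.mem_image.1 hv
      rw [Finset.mem_range] at hi
      have h1 := S.one_lt_rowLabel hi
      have h2 := hq.rowLabel_le hi
      have h3 := S.le_card_freeEdges hq h0 hov
      rw [hq.rowLabel_eq] at h2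
      omega
    · obtain ⟨s, hs, rfl⟩ := Finset.mem_image.1 hv
      have h1 := S.southIndex_mem h0 hov hs
      rw [S.southLabel_eq h1.1]
      have h2 := S.one_le_up.2 h1.1
      have h3 := up_le e R (southIndex P s)
      omega
  · rw [S.image_labelValue, S.card_labels h0 hov (fun i hi => Finset.mem_range.1 hi) subset_rfl]
    simp

lemma injOn_labelValue (h0 : l 0 = 1) (hov : ∀ i, i + 1 < R → l (i + 1) ≤ e i) :
    Set.InjOn labelValue (placedLabels P) := by
  apply Finset.injOn_of_card_image_eq
  apply le_antisymm Finset.card_image_le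
  rw [S.image_labelValue, S.card_labels h0 hov (fun i hi => Finset.mem_range.1 hi) subset_rfl,
    S.placedLabels_eq]
  exact (Finset.card_union_le _ _).trans (add_le_add Finset.card_image_le Finset.card_image_le)

/-- The word of a polyomino is a permutation, and its rows describe the inverse permutation. -/
theorem exists_perm (hR : 0 < R) (h0 : l 0 = 1) (hov : ∀ i, i + 1 < R → l (i + 1) ≤ e i) :
    ∃ (n : ℕ) (σ : Equiv.Perm ℤ), IsPermutation n σ ∧ readingWord P = oneLine n σ ∧
      Link n σ⁻¹ R l e := by
  classical
  have himg := S.image_labelValue_eq hR h0 hov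
  obtain ⟨σ, hσ, hword, hpos⟩ := exists_perm_of_sort (placedLabels P) labelValue _
    (S.injOn_labelValue h0 hov) himg
  set n := R + (freeEdges P).card with hn
  set Q := placedLabels P with hQ
  have hQeq : Q = (Finset.range R).image (eastKey h e) ∪ (freeEdges P).image (southKey P) :=
    S.placedLabels_eq
  have hEQ : ∀ i < R, eastKey h e i ∈ Q := fun i hi => by
    rw [hQeq]
    exact Finset.mem_union_left _ (Finset.mem_image_of_mem _ (Finset.mem_range.2 hi))
  have hSQ : ∀ s ∈ freeEdges P, southKey P s ∈ Q := fun s hs => by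
    rw [hQeq]
    exact Finset.mem_union_right _ (Finset.mem_image_of_mem _ hs)
  have hQcases : ∀ t ∈ Q, (∃ i < R, t = eastKey h e i) ∨ ∃ s ∈ freeEdges P, t = southKey P s := by
    intro t ht
    rw [hQeq] at ht
    rcases Finset.mem_union.1 ht with ht | ht
    · obtain ⟨i, hi, rfl⟩ := Finset.mem_image.1 ht
      exact Or.inl ⟨i, Finset.mem_range.1 hi, rfl⟩
    · obtain ⟨s, hs, rfl⟩ := Finset.mem_image.1 ht
      exact Or.inr ⟨s, hs, rfl⟩
  have hvQ : ∀ v, 1 ≤ v → v ≤ (n : ℤ) → ∃ t ∈ Q, labelValue t = v := by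
    intro v h1 h2
    have : v ∈ Q.image labelValue := by
      rw [himg, Finset.mem_Icc]
      exact ⟨h1, h2⟩
    exact Finset.mem_image.1 this
  have hrange : ∀ t ∈ Q, 1 ≤ labelValue t ∧ labelValue t ≤ (n : ℤ) := by
    intro t ht
    have := Finset.mem_image_of_mem labelValue ht
    rwa [himg, Finset.mem_Icc] at this
  have hlt : ∀ t ∈ Q, ∀ t' ∈ Q, (σ⁻¹ (labelValue t) < σ⁻¹ (labelValue t') ↔ t < t') := by
    have hone : ∀ t ∈ Q, ∀ t' ∈ Q, t < t' → σ⁻¹ (labelValue t) < σ⁻¹ (labelValue t') := by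
      intro t ht t' ht' h1
      rw [hpos t ht, hpos t' ht']
      have : Q.filter (· < t) ⊂ Q.filter (· < t') := by
        rw [Finset.ssubset_iff_of_subset]
        · exact ⟨t, Finset.mem_filter.2 ⟨ht, h1⟩, fun h2 =>
            lt_irrefl _ (Finset.mem_filter.1 h2).2⟩
        · intro u hu
          rw [Finset.mem_filter] at hu ⊢
          exact ⟨hu.1, hu.2.trans h1⟩
      have := Finset.card_lt_card this
      omega
    intro t ht t' ht'
    refine ⟨fun h1 => ?_, hone t ht t' ht'⟩
    by_contra hc
    rcases (not_lt.1 hc).eq_or_lt with h2 | h2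
    · rw [h2] at h1
      exact lt_irrefl _ h1
    · exact lt_asymm h1 (hone t' ht' t ht h2)
  have hbefore : ∀ i < R, Q.filter (· < eastKey h e i) =
      (Finset.range i).image (eastKey h e) ∪
        ((freeEdges P).filter fun s => s.1 < l i).image (southKey P) := by
    intro i hi
    ext t
    rw [Finset.mem_filter, Finset.mem_union, Finset.mem_image, Finset.mem_image]
    constructor
    · rintro ⟨ht, h1⟩
      rcases hQcases t ht with ⟨j, hj, rfl⟩ | ⟨s, hs, rfl⟩
      · exact Or.inl ⟨j, Finset.mem_range.2 (eastKey_lt.1 h1), rfl⟩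
      · exact Or.inr ⟨s, Finset.mem_filter.2 ⟨hs, (S.southKey_lt_eastKey hs hi).1 h1⟩, rfl⟩
    · rintro (⟨j, hj, rfl⟩ | ⟨s, hs, rfl⟩)
      · rw [Finset.mem_range] at hj
        exact ⟨hEQ j (by omega), eastKey_lt.2 hj⟩
      · rw [Finset.mem_filter] at hs
        exact ⟨hSQ s hs.1, (S.southKey_lt_eastKey hs.1 hi).2 hs.2⟩
  refine ⟨n, σ, hσ, hword, hσ.inv, fun i hi => (hrange _ (hEQ i hi)).2, ?_, ?_, ?_⟩
  -- The label of row `i` is preceded by the labels of the `i` rows above and by `l i - 1` south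
  -- labels.
  · intro i hi
    have h1 := hpos _ (hEQ i hi)
    rw [labelValue_eastKey] at h1
    rw [h1, ← Finset.card_image_of_injOn ((S.injOn_labelValue h0 hov).mono
      (Finset.coe_subset.2 (Finset.filter_subset _ _))), hbefore i hi, Finset.image_union,
      Finset.image_image, Finset.image_image]
    have h2 := S.card_labels h0 hov (A := Finset.range i)
      (B := (freeEdges P).filter fun s => s.1 < l i)
      (fun j hj => (Finset.mem_range.1 hj).trans hi) (Finset.filter_subset _ _)
    have h3 : labelValue ∘ eastKey h e = rowLabel e := rfl
    have h4 : labelValue ∘ southKey P = southLabel P := rfl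
    rw [h3, h4, h2, Finset.card_range]
    have := S.card_free_left h0 hov hi
    push_cast
    omega
  · intro i hi
    have hin := hrange _ (hEQ i hi)
    rw [labelValue_eastKey] at hin
    -- The code is found from the complement: of the `rowLabel e i - 1` smaller labels, those read
    -- earlier are `rowLabel e i - (e i + 1)` labels of rows above and `l i - 1` south labels.
    have hset : (Finset.Ico 1 (rowLabel e i)).filter
        (fun v => ¬ σ⁻¹ (rowLabel e i) < σ⁻¹ v) =
        ((Finset.range i).filter fun j => rowLabel e j < rowLabel e i).image (rowLabel e) ∪
          ((freeEdges P).filter fun s => s.1 < l i).image (southLabel P) := by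
      ext v
      rw [Finset.mem_filter, Finset.mem_Ico, Finset.mem_union, Finset.mem_image,
        Finset.mem_image]
      constructor
      · rintro ⟨⟨h1, h2⟩, h3⟩
        obtain ⟨t, ht, rfl⟩ := hvQ v h1 (by omega)
        have h4 : t < eastKey h e i := by
          rw [← hlt t ht _ (hEQ i hi), labelValue_eastKey]
          have h5 : σ⁻¹ (labelValue t) ≠ σ⁻¹ (rowLabel e i) := fun h6 => by
            have := (σ⁻¹).injective h6
            omega
          omega
        rcases hQcases t ht with ⟨j, hj, rfl⟩ | ⟨s, hs, rfl⟩
        · exact Or.inl ⟨j, Finset.mem_filter.2 ⟨Finset.mem_range.2 (eastKey_lt.1 h4), h2⟩, rfl⟩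
        · exact Or.inr ⟨s, Finset.mem_filter.2 ⟨hs, (S.southKey_lt_eastKey hs hi).1 h4⟩, rfl⟩
      · rintro (⟨j, hj, rfl⟩ | ⟨s, hs, rfl⟩)
        · rw [Finset.mem_filter, Finset.mem_range] at hj
          have h1 := (hlt _ (hEQ j (by omega)) _ (hEQ i hi)).2 (eastKey_lt.2 hj.1)
          rw [labelValue_eastKey, labelValue_eastKey] at h1
          exact ⟨⟨(S.one_lt_rowLabel (by omega)).le, hj.2⟩, h1.not_gt⟩
        · rw [Finset.mem_filter] at hs
          have h1 := (hlt _ (hSQ s hs.1) _ (hEQ i hi)).2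
            ((S.southKey_lt_eastKey hs.1 hi).2 hs.2)
          rw [labelValue_eastKey, labelValue_southKey] at h1
          exact ⟨⟨(hrange _ (hSQ s hs.1)).1, S.southLabel_lt_rowLabel hs.1 hi hs.2⟩, h1.not_gt⟩
    have h1 := Finset.card_filter_add_card_filter_not
      (s := Finset.Ico 1 (rowLabel e i)) (fun v => σ⁻¹ (rowLabel e i) < σ⁻¹ v)
    rw [hset, S.card_labels h0 hov
      (fun j hj => (Finset.mem_range.1 (Finset.mem_filter.1 hj).1).trans hi)
      (Finset.filter_subset _ _), Int.card_Ico] at h1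
    have h2 := S.card_free_left h0 hov hi
    have h3 := card_rowLabel_lt_up (e := e) i (e i + 1)
    change (((Finset.range i).filter fun j => rowLabel e j < rowLabel e i).card : ℤ) =
      rowLabel e i - (e i + 1) at h3
    unfold code
    omega
  · intro v h1 h2 hv
    rw [code_eq_zero]
    intro j hj1 hjv
    obtain ⟨t, ht, rfl⟩ := hvQ v h1 h2
    obtain ⟨t', ht', rfl⟩ := hvQ j hj1 (by omega)
    rw [hlt t' ht' t ht]
    rcases hQcases t ht with ⟨i, hi, rfl⟩ | ⟨s, hs, rfl⟩
    · exact absurd rfl (hv i hi)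
    -- All labels smaller than a south label are read before it: a south label read before an east
    -- label is smaller than it, and the south labels are read in increasing order.
    rcases hQcases t' ht' with ⟨i, hi, rfl⟩ | ⟨s', hs', rfl⟩
    · rw [labelValue_eastKey, labelValue_southKey] at hjv
      by_contra hc
      rcases (not_lt.1 hc).eq_or_lt with h3 | h3
      · have := congrArg labelValue h3
        rw [labelValue_eastKey, labelValue_southKey] at this
        omega
      · have := S.southLabel_lt_rowLabel hs hi ((S.southKey_lt_eastKey hs hi).1 h3)
        omega
    · rw [labelValue_southKey, labelValue_southKey] at hjv
      exact S.southKey_lt_southKey hs' hs ((S.southLabel_lt_iff h0 hov hs' hs).1 hjv)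

end RowShape
end PolyNet

theorem mainTheorem6 (P : Finset PolyNet.Cell) (hP : PolyNet.IsAdmissible P) :
    ∃ (n : ℕ) (π : Equiv.Perm ℤ),
      PolyNet.IsPermutation n π ∧
      PolyNet.readingWord P = PolyNet.oneLine n π ∧
      (∃ q : ℕ, PolyNet.reduce^[q + 1] P = ∅) ∧
      PolyNet.IsNetwork n (PolyNet.polyominoEdges P) ∧
      PolyNet.polyominoEdges P = PolyNet.permNetwork n π⁻¹ := by
  obtain ⟨h, R, l, e, S, hR, h0, hov⟩ := hP.exists_rowShape
  obtain ⟨n, σ, hσ, hword, hL⟩ := S.exists_perm hR h0 hov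
  obtain ⟨⟨k, hk⟩, hE⟩ := S.polyominoEdges_eq_permNetwork hL
  refine ⟨n, σ, hσ, hword, ⟨k, ?_⟩, ?_, hE⟩
  · rw [Function.iterate_succ_apply', hk, PolyNet.reduce_empty]
  · rw [hE]
    exact PolyNet.isNetwork_permNetwork hσ.inv
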